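/- **Setting.** Let $\gamma:[1,\infty)\to\mathbb R$ be differentiable with $\gamma'>0$, $\gamma(1)=1$, $\gamma<\tilde U$ and $\gamma(v)\to\tilde U<\infty$ as $v\to\infty$. Let $$\mathcal Q=\{(u,v): v\ge 1,\ \gamma(v)\le u\le \tilde U\},\qquad \Gamma=\{(\gamma(v),v):v\ge1\},\qquad \mathcal H=\{u=\tilde U\}\subset\mathcal Q .$$ So $\mathcal Q$ is bounded by the ingoing null ray $v=1$, the timelike curve $\Gamma$ and the outgoing null ray $\mathcal H$ (the event horizon), and every outgoing ray $u=u_0<\tilde U$ meets $\Gamma$. Let $-\Omega^2\,du\,dv$ ($\Omega>0$) be a metric on $\mathcal Q$ and let $r>0$ (area radius) and $\phi$ (scalar field) be functions on $\mathcal Q$, with $\Omega$ continuous and $r,\phi$ of class $C^1$ (derivatives at boundary points are one-sided, extended continuously to the corner $(1,1)$). Put $\lambda=\partial_v r$, $\nu=\partial_u r$, $\theta=r\partial_v\phi$, $\zeta=r\partial_u\phi$, let $m=\frac r2(1+4\Omega^{-2}\lambda\nu)$ be the Hawking mass, $\mu=2m/r$, and, for a constant $e\in\mathbb R$, let $\varpi=m+\frac{e^2}{2r}$.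 Note $1-\mu=-4\Omega^{-2}\lambda\nu$; below, $\frac{\lambda\nu}{1-\mu}$, $\frac{1-\mu}{\nu}$ and $\frac{1-\mu}{\lambda}$ stand for $-\frac{\Omega^2}{4}$, $-4\Omega^{-2}\lambda$ and $-4\Omega^{-2}\nu$, also where $\lambda$ or $\nu$ vanishes. Suppose that for some constant $R$ * on $\Gamma$: $r=R$, $\lambda=1$ and $\sup_\Gamma 2m<R$; * on $v=1$: $\nu=-1$, $\zeta$ is bounded, $r>c$ for some constant $c>0$; and $m\ge0$ at $(\tilde U,1)$. **Theorem.** Suppose that one of the following holds. 1. *(Coupled case.)* The fields solve the spherically symmetric Einstein–Maxwell–scalar field system pointwise on $\mathcal Q$: $$\partial_u\lambda=\partial_v\nu=\frac{2\lambda\nu}{1-\mu}\Big(\frac{\varpi}{r^2}-\frac{e^2}{r^3}\Big),\quad \partial_u\theta=-\frac{\zeta\lambda}{r},\quad \partial_v\zeta=-\frac{\theta\nu}{r},$$ $$\partial_u\varpi=\tfrac12\,\frac{1-\mu}{\nu}\,\zeta^2,\qquad \partial_v\varpi=\tfrac12\,\frac{1-\mu}{\lambda}\,\theta^2;$$ the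 Hawking mass $m$ is non-increasing in $v$ along $\Gamma$; and, if $e\ne0$, the black hole is not extremal in the limit, i.e. $|e|<\sup_{\mathcal H}\varpi$. 2. *(Wave equation on a fixed background.)* For a constant $M>|e|$ the metric is that of Schwarzschild ($e=0$) or subextremal Reissner–Nordström ($e\neq 0$): $\varpi\equiv M$ and $\partial_u\lambda=\partial_v\nu=\frac{2\lambda\nu}{1-\mu}\big(\frac{M}{r^2}-\frac{e^2}{r^3}\big)$ on $\mathcal Q$. The field satisfies the wave equation $\partial_u\theta=-\frac{\zeta\lambda}{r}$, $\partial_v\zeta=-\frac{\theta\nu}{r}$, and its energy function $E$ on $\mathcal Q$, given by $\partial_uE=\frac12\frac{1-\mu}{\nu}\zeta^2$ and $\partial_vE=\frac12\frac{1-\mu}{\lambda}\theta^2$, is non-increasing in $v$ along $\Gamma$. Then for every $p>0$ there is a constant $C$ (depending on $p$ and the solution) such that $$|\theta(u,v)|=|r\,\partial_v\phi(u,v)|\le C\,v^{-p}\qquad\text{for all }(u,v)\in\mathcal Q .$$ -/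

import Mathlib

open Set Filter Topology

namespace SphericalCollapse

/-- A function `f` of the null coordinates `(u, v)` has partial derivative `g` in `u` on `Q`
(one-sided at boundary points of `Q`). -/
def HasPartialU (Q : Set (ℝ × ℝ)) (f g : ℝ → ℝ → ℝ) : Prop :=
  ∀ u v : ℝ, (u, v) ∈ Q →
    HasDerivWithinAt (fun u' => f u' v) (g u v) {u' | (u', v) ∈ Q} u

/-- A function `f` of the null coordinates `(u, v)` has partial derivative `g` in `v` on `Q`
(one-sided at boundary points of `Q`). -/
def HasPartialV (Q : Set (ℝ × ℝ)) (f g : ℝ → ℝ → ℝ) : Prop :=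
  ∀ u v : ℝ, (u, v) ∈ Q →
    HasDerivWithinAt (fun v' => f u v') (g u v) {v' | (u, v') ∈ Q} v

/-- Joint continuity on `Q` of a function of the null coordinates. -/
def ContOn (Q : Set (ℝ × ℝ)) (f : ℝ → ℝ → ℝ) : Prop :=
  ContinuousOn (fun p : ℝ × ℝ => f p.1 p.2) Q

/-- The region bounded by the ingoing null ray `v = 1`, the curve `Γ = {u = γ v}` and the outgoing
null ray `u = U`. The two null rays and `Γ` belong to the region. -/
def region (γ : ℝ → ℝ) (U : ℝ) : Set (ℝ × ℝ) :=
  {p | 1 ≤ p.2 ∧ γ p.2 ≤ p.1 ∧ p.1 ≤ U}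

/-- `Γ = {(γ v, v) : v ≥ 1}` is a timelike curve from `(1, 1)` that does not meet the ray `u = U`,
and `u = U` is the event horizon with respect to `Γ`, i.e. the boundary of the past of `Γ`:
every outgoing ray `u = u₀` with `1 ≤ u₀ < U` meets `Γ`. -/
structure IsTimelikeBoundary (γ : ℝ → ℝ) (U : ℝ) : Prop where
  start : γ 1 = 1
  timelike : ∀ v, 1 ≤ v → ∃ s, 0 < s ∧ HasDerivWithinAt γ s (Ici 1) v
  lt_horizon : ∀ v, 1 ≤ v → γ v < U
  tendsto_horizon : Tendsto γ atTop (𝓝 U)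

/-- The fields on the quotient spacetime with metric `-Ω² du dv`: the area radius `r`, its null
derivatives `lam = ∂_v r` and `nu = ∂_u r`, the scalar field `φ`, and `θ = r ∂_v φ`,
`ζ = r ∂_u φ`. -/
structure Fields where
  r : ℝ → ℝ → ℝ
  Ω : ℝ → ℝ → ℝ
  lam : ℝ → ℝ → ℝ
  nu : ℝ → ℝ → ℝ
  φ : ℝ → ℝ → ℝ
  θ : ℝ → ℝ → ℝ
  ζ : ℝ → ℝ → ℝ

namespace Fields

/-- The Hawking mass `m = (r / 2) (1 + 4 Ω⁻² ∂_u r ∂_v r)`. With `μ = 2 m / r` this says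
`1 - μ = -4 Ω⁻² lam nu`. -/
noncomputable def hawkingMass (S : Fields) (u v : ℝ) : ℝ :=
  S.r u v / 2 * (1 + 4 / S.Ω u v ^ 2 * S.nu u v * S.lam u v)

/-- The renormalized Hawking mass `ϖ = m + e² / (2 r)`. -/
noncomputable def renormMass (S : Fields) (e u v : ℝ) : ℝ :=
  S.hawkingMass u v + e ^ 2 / (2 * S.r u v)

/-- Regularity: `r > 0`, `Ω > 0`, all fields are continuous on `Q`, and `lam`, `nu`, `θ`, `ζ` are
the null derivatives of `r` and `r` times the null derivatives of `φ`. -/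
structure IsRegular (S : Fields) (Q : Set (ℝ × ℝ)) : Prop where
  r_pos : ∀ u v, (u, v) ∈ Q → 0 < S.r u v
  Ω_pos : ∀ u v, (u, v) ∈ Q → 0 < S.Ω u v
  r_cont : ContOn Q S.r
  Ω_cont : ContOn Q S.Ω
  lam_cont : ContOn Q S.lam
  nu_cont : ContOn Q S.nu
  φ_cont : ContOn Q S.φ
  θ_cont : ContOn Q S.θ
  ζ_cont : ContOn Q S.ζ
  r_u : HasPartialU Q S.r S.nu
  r_v : HasPartialV Q S.r S.lam
  φ_u : HasPartialU Q S.φ (fun u v => S.ζ u v / S.r u v)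
  φ_v : HasPartialV Q S.φ (fun u v => S.θ u v / S.r u v)

/-- The equations `∂_u lam = lam (2 nu / (1 - μ)) (ϖ / r² - e² / r³)` and
`∂_v nu = nu (2 lam / (1 - μ)) (ϖ / r² - e² / r³)`. They are written with
`lam nu / (1 - μ) = -Ω² / 4`, which is meaningful also at points of the horizon where
`lam = 1 - μ = 0`. -/
structure RadiusEquations (S : Fields) (Q : Set (ℝ × ℝ)) (e : ℝ) : Prop where
  lam_u : HasPartialU Q S.lam (fun u v =>
    -(S.Ω u v ^ 2 / 2) * (S.renormMass e u v / S.r u v ^ 2 - e ^ 2 / S.r u v ^ 3))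
  nu_v : HasPartialV Q S.nu (fun u v =>
    -(S.Ω u v ^ 2 / 2) * (S.renormMass e u v / S.r u v ^ 2 - e ^ 2 / S.r u v ^ 3))

/-- The spherically symmetric wave equation for `φ`:
`∂_u θ = -ζ lam / r` and `∂_v ζ = -θ nu / r`. -/
structure WaveEquation (S : Fields) (Q : Set (ℝ × ℝ)) : Prop where
  θ_u : HasPartialU Q S.θ (fun u v => -(S.ζ u v * S.lam u v / S.r u v))
  ζ_v : HasPartialV Q S.ζ (fun u v => -(S.θ u v * S.nu u v / S.r u v))

/-- `w` is a mass (energy) function of the scalar field: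
`∂_u w = (1/2) (1 - μ) (ζ / nu)² nu` and `∂_v w = (1/2) (1 - μ) (θ / lam)² lam`.
They are written with `(1 - μ) / nu = -4 Ω⁻² lam` and `(1 - μ) / lam = -4 Ω⁻² nu`. -/
structure MassEquations (S : Fields) (Q : Set (ℝ × ℝ)) (w : ℝ → ℝ → ℝ) : Prop where
  w_u : HasPartialU Q w (fun u v => -(2 / S.Ω u v ^ 2 * S.lam u v * S.ζ u v ^ 2))
  w_v : HasPartialV Q w (fun u v => -(2 / S.Ω u v ^ 2 * S.nu u v * S.θ u v ^ 2))

/-- The fields form a classical solution on `Q` of the spherically symmetric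
Einstein-Maxwell-scalar field system with charge parameter `e`. -/
structure IsEinsteinMaxwellScalar (S : Fields) (Q : Set (ℝ × ℝ)) (e : ℝ) : Prop where
  regular : S.IsRegular Q
  radius : S.RadiusEquations Q e
  wave : S.WaveEquation Q
  mass : S.MassEquations Q (S.renormMass e)

/-- `φ` is a classical spherically symmetric solution on `Q` of the wave equation on a fixed
Reissner-Nordström background with mass parameter `M` and charge parameter `e` (Schwarzschild if
`e = 0`): the metric solves the system with constant renormalized mass `M`, unaffected by `φ`. -/
structure IsWaveOnReissnerNordstrom (S : Fields) (Q : Set (ℝ × ℝ)) (M e : ℝ) : Prop where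
  regular : S.IsRegular Q
  radius : S.RadiusEquations Q e
  const_mass : ∀ u v, (u, v) ∈ Q → S.renormMass e u v = M
  wave : S.WaveEquation Q

/-- The conditions on the boundary curve `Γ` and on the initial ingoing ray that fix the null
coordinates and restrict the geometry, and boundedness of the initial datum `ζ`. -/
structure BoundaryConditions (S : Fields) (γ : ℝ → ℝ) (U R : ℝ) : Prop where
  r_bdry : ∀ v, 1 ≤ v → S.r (γ v) v = R
  lam_bdry : ∀ v, 1 ≤ v → S.lam (γ v) v = 1
  mass_bdry : ∃ M₀, M₀ < R ∧ ∀ v, 1 ≤ v → 2 * S.hawkingMass (γ v) v ≤ M₀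
  nu_init : ∀ u, 1 ≤ u → u ≤ U → S.nu u 1 = -1
  ζ_init : ∃ B, ∀ u, 1 ≤ u → u ≤ U → |S.ζ u 1| ≤ B
  r_init : ∃ c, 0 < c ∧ ∀ u, 1 ≤ u → u ≤ U → c < S.r u 1
  mass_init : 0 ≤ S.hawkingMass U 1

end Fields

end SphericalCollapse

/-!
The decay is in fact exponential in `v`. It follows from four observations, and all estimates are
comparisons of functions along single null rays.

*Signs.* On the timelike curve `nu < 0 < lam`. The Raychaudhuri equations say that `4 Ω⁻² lam` does
not increase in `v` and that `1 / κ = (1 - μ) / lam = -4 Ω⁻² nu` does not decrease in `u`. As every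
outgoing ray before the horizon meets the curve, this gives `nu < 0` everywhere and `lam > 0` before
the horizon (`nu_neg`, `lam_pos`), and with it monotonicity of the mass `ϖ` and of the energy `E`
in `u` and in `v` and bounds for `r`, `lam` and `κ`.

*Redshift.* Once the mass of the horizon exceeds `|e|`, the factor `ϖ / r² - e² / r³` is bounded
below by a positive constant in the whole late region (`exists_le_redshift`): the radius `|e|` is not
attained, and if the curve lay at a smaller radius, `lam` would be at least `1` on the horizon, whose
radius would then be unbounded. Therefore `Z = ζ / nu` satisfies
`∂_v Z² ≤ -2 κ (ϖ / r² - e² / r³) Z² + C ∂_v E` (`ingoing_sq_deriv_le`). This bounds `Z`, hence `1 / κ`.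
In the uncharged coupled case the mass of the horizon is shown to be positive by
`exists_horizon_mass_pos`.

*Decay.* Let `F v` be the energy of the ingoing ray at `v`, the difference of `E` on the curve and on
the horizon. Integrating the redshift inequality from `v` to `v + T` and applying Grönwall's
inequality in `r` along the ray at `v + T` bounds both `sup Z²` and `F` at `v + T` by
`C (exp (-a T) sup Z² + F v - F (v + T))`, because the flux through the horizon is at most the
energy lost (`exists_decay_step`). For large `T` a combination of `sup Z²` and `F` therefore shrinks
by a fixed factor (`exists_geometric_decay`).

*The outgoing derivative.* That `E` does not increase along the curve means `|θ| ≤ |Z|` there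
(`θ_sq_curve_le`), and `∂_u θ = -Z nu lam / r` carries the decay of `Z` over to `θ` on the whole ray
(`exists_θ_le`).
-/

/-! ### Comparison of functions of one variable -/

/-- Monotonicity on a compact interval, with derivatives required only in the interior. -/
lemma le_of_hasDerivAt_nonpos {f f' : ℝ → ℝ} {a b : ℝ} (hab : a ≤ b)
    (hc : ContinuousOn f (Icc a b)) (hd : ∀ x ∈ Ioo a b, HasDerivAt f (f' x) x)
    (hn : ∀ x ∈ Ioo a b, f' x ≤ 0) : f b ≤ f a := by
  refine antitoneOn_of_hasDerivWithinAt_nonpos (convex_Icc a b) hc (f' := f') ?_ ?_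
    (left_mem_Icc.2 hab) (right_mem_Icc.2 hab) hab
  · intro x hx
    rw [interior_Icc] at hx ⊢
    exact (hd x hx).hasDerivWithinAt
  · intro x hx
    rw [interior_Icc] at hx
    exact hn x hx

lemma le_of_hasDerivAt_nonneg {f f' : ℝ → ℝ} {a b : ℝ} (hab : a ≤ b)
    (hc : ContinuousOn f (Icc a b)) (hd : ∀ x ∈ Ioo a b, HasDerivAt f (f' x) x)
    (hn : ∀ x ∈ Ioo a b, 0 ≤ f' x) : f a ≤ f b := by
  have := le_of_hasDerivAt_nonpos (f := fun x => -f x) (f' := fun x => -f' x) hab hc.neg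
    (fun x hx => (hd x hx).neg) (fun x hx => by linarith [hn x hx])
  linarith

namespace SphericalCollapse

variable {γ : ℝ → ℝ} {U : ℝ}

/-! ### The timelike curve and the region -/

namespace IsTimelikeBoundary

lemma continuousOn (h : IsTimelikeBoundary γ U) : ContinuousOn γ (Ici 1) := fun v hv => by
  obtain ⟨s, -, hs⟩ := h.timelike v hv
  exact hs.continuousWithinAt

lemma strictMonoOn (h : IsTimelikeBoundary γ U) : StrictMonoOn γ (Ici 1) := by
  choose! s hs using h.timelike
  refine strictMonoOn_of_hasDerivWithinAt_pos (convex_Ici 1) h.continuousOn (f' := s) ?_ ?_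
  · intro x hx
    have hx' : x ∈ Ici (1 : ℝ) := interior_subset hx
    exact (hs x hx').2.mono interior_subset
  · intro x hx
    have hx' : x ∈ Ici (1 : ℝ) := interior_subset hx
    exact (hs x hx').1

lemma mono (h : IsTimelikeBoundary γ U) {v w : ℝ} (hv : 1 ≤ v) (hvw : v ≤ w) : γ v ≤ γ w :=
  h.strictMonoOn.monotoneOn hv (hv.trans hvw) hvw

lemma one_le (h : IsTimelikeBoundary γ U) {v : ℝ} (hv : 1 ≤ v) : 1 ≤ γ v := by
  simpa [h.start] using h.mono le_rfl hv

/-- Every outgoing ray before the horizon meets the timelike curve. -/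
lemma exists_eq (h : IsTimelikeBoundary γ U) {u : ℝ} (hu : 1 ≤ u) (huU : u < U) :
    ∃ V, 1 ≤ V ∧ γ V = u := by
  obtain ⟨w, hw1, hw⟩ := ((eventually_ge_atTop (1 : ℝ)).and
    (h.tendsto_horizon.eventually (lt_mem_nhds huU))).exists
  obtain ⟨V, hV, hVu⟩ := intermediate_value_Icc hw1
    (h.continuousOn.mono fun x hx => hx.1) (show u ∈ Icc (γ 1) (γ w) from
      ⟨by rw [h.start]; exact hu, hw.le⟩)
  exact ⟨V, hV.1, hVu⟩

lemma le_of_le (h : IsTimelikeBoundary γ U) {v w : ℝ} (hv : 1 ≤ v) (hw : 1 ≤ w)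
    (hvw : γ v ≤ γ w) : v ≤ w :=
  (h.strictMonoOn.le_iff_le hv hw).1 hvw

lemma curve_mem (h : IsTimelikeBoundary γ U) {v : ℝ} (hv : 1 ≤ v) : (γ v, v) ∈ region γ U :=
  ⟨hv, le_rfl, (h.lt_horizon v hv).le⟩

lemma horizon_mem (h : IsTimelikeBoundary γ U) {v : ℝ} (hv : 1 ≤ v) : (U, v) ∈ region γ U :=
  ⟨hv, (h.lt_horizon v hv).le, le_rfl⟩

lemma mem_of_le_v (h : IsTimelikeBoundary γ U) {u v w : ℝ} (hm : (u, v) ∈ region γ U)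
    (hw : 1 ≤ w) (hwv : w ≤ v) : (u, w) ∈ region γ U :=
  ⟨hw, (h.mono hw hwv).trans hm.2.1, hm.2.2⟩

/-- The part of the region up to a given advanced time is compact. -/
lemma isCompact_inter (h : IsTimelikeBoundary γ U) (w : ℝ) :
    IsCompact {p : ℝ × ℝ | p ∈ region γ U ∧ p.2 ≤ w} := by
  have hcl : IsClosed {p : ℝ × ℝ | p ∈ Icc (1 : ℝ) U ×ˢ Icc (1 : ℝ) w ∧ γ p.2 ≤ p.1} :=
    (isClosed_Icc.prod isClosed_Icc).isClosed_le
      (h.continuousOn.comp continuousOn_snd fun p hp => hp.2.1) continuousOn_fst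
  have := (isCompact_Icc.prod isCompact_Icc).of_isClosed_subset hcl (fun p hp => hp.1)
  convert this using 1
  ext p
  simp only [region, mem_ofPred_eq, mem_prod, mem_Icc]
  constructor
  · rintro ⟨⟨h1, h2, h3⟩, h4⟩
    exact ⟨⟨⟨(h.one_le h1).trans h2, h3⟩, h1, h4⟩, h2⟩
  · rintro ⟨⟨⟨-, h3⟩, h1, h4⟩, h2⟩
    exact ⟨⟨h1, h2, h3⟩, h4⟩

end IsTimelikeBoundary

lemma mem_of_le_u {u u' v : ℝ} (hm : (u, v) ∈ region γ U) (h1 : u ≤ u') (h2 : u' ≤ U) :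
    (u', v) ∈ region γ U :=
  ⟨hm.1, hm.2.1.trans h1, h2⟩

/-! ### Restriction to null rays -/

section Slices

variable {f g : ℝ → ℝ → ℝ} {u v : ℝ}

lemma ContOn.slice_u (hf : ContOn (region γ U) f) (hm : (u, v) ∈ region γ U) :
    ContinuousOn (fun x => f x v) (Icc u U) :=
  hf.comp (f := fun x : ℝ => (x, v)) (by fun_prop) fun _ hx => mem_of_le_u hm hx.1 hx.2

lemma ContOn.slice_v (h : IsTimelikeBoundary γ U) (hf : ContOn (region γ U) f)
    (hm : (u, v) ∈ region γ U) : ContinuousOn (fun x => f u x) (Icc 1 v) :=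
  hf.comp (f := fun x : ℝ => (u, x)) (by fun_prop) fun _ hx => h.mem_of_le_v hm hx.1 hx.2

lemma HasPartialU.continuousOn (hf : HasPartialU (region γ U) f g) (hm : (u, v) ∈ region γ U) :
    ContinuousOn (fun x => f x v) (Icc u U) := fun x hx =>
  ((hf x v (mem_of_le_u hm hx.1 hx.2)).continuousWithinAt).mono
    fun _ hy => mem_of_le_u hm hy.1 hy.2

lemma HasPartialV.continuousOn (h : IsTimelikeBoundary γ U) (hf : HasPartialV (region γ U) f g)
    (hm : (u, v) ∈ region γ U) : ContinuousOn (fun x => f u x) (Icc 1 v) := fun x hx =>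
  ((hf u x (h.mem_of_le_v hm hx.1 hx.2)).continuousWithinAt).mono
    fun _ hy => h.mem_of_le_v hm hy.1 hy.2

lemma HasPartialU.hasDerivAt (hf : HasPartialU (region γ U) f g) (hm : (u, v) ∈ region γ U)
    {x : ℝ} (hx : x ∈ Ioo u U) : HasDerivAt (fun y => f y v) (g x v) x :=
  (hf x v (mem_of_le_u hm hx.1.le hx.2.le)).hasDerivAt <|
    Filter.mem_of_superset (Icc_mem_nhds hx.1 hx.2) fun _ hy => mem_of_le_u hm hy.1 hy.2

lemma HasPartialV.hasDerivAt (h : IsTimelikeBoundary γ U) (hf : HasPartialV (region γ U) f g)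
    (hm : (u, v) ∈ region γ U) {x : ℝ} (hx : x ∈ Ioo 1 v) :
    HasDerivAt (fun y => f u y) (g u x) x :=
  (hf u x (h.mem_of_le_v hm hx.1.le hx.2.le)).hasDerivAt <|
    Filter.mem_of_superset (Icc_mem_nhds hx.1 hx.2) fun _ hy => h.mem_of_le_v hm hy.1 hy.2

/-- A function with nonpositive `u`-derivative is nonincreasing along ingoing rays. -/
lemma HasPartialU.le (hf : HasPartialU (region γ U) f g) (hm : (u, v) ∈ region γ U) {u' : ℝ}
    (h1 : u ≤ u') (h2 : u' ≤ U) (hg : ∀ x ∈ Ioo u u', g x v ≤ 0) : f u' v ≤ f u v :=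
  le_of_hasDerivAt_nonpos (f' := fun x => g x v) h1
    ((hf.continuousOn hm).mono (Icc_subset_Icc_right h2))
    (fun _ hx => hf.hasDerivAt hm ⟨hx.1, hx.2.trans_le h2⟩) hg

/-- A function with nonnegative `v`-derivative is nondecreasing along outgoing rays. -/
lemma HasPartialV.le (h : IsTimelikeBoundary γ U) (hf : HasPartialV (region γ U) f g)
    (hm : (u, v) ∈ region γ U) {w : ℝ} (hw : 1 ≤ w) (hwv : w ≤ v)
    (hg : ∀ x ∈ Ioo w v, 0 ≤ g u x) : f u w ≤ f u v :=
  le_of_hasDerivAt_nonneg (f' := fun x => g u x) hwv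
    ((hf.continuousOn h hm).mono (Icc_subset_Icc_left hw))
    (fun _ hx => hf.hasDerivAt h hm ⟨hw.trans_lt hx.1, hx.2⟩) hg

/-- The chain rule along the timelike curve, from the right. The curve lies in the boundary of the
region, so that only one-sided partial derivatives are available; the increment is split at the
corner `(γ w, v)`, which belongs to the region for `w ≥ v`. -/
lemma hasDerivWithinAt_curve (h : IsTimelikeBoundary γ U) {fu fv : ℝ → ℝ → ℝ}
    (hu : HasPartialU (region γ U) f fu) (hv : HasPartialV (region γ U) f fv)
    (hc : ContOn (region γ U) fv) {v s : ℝ} (h1 : 1 ≤ v)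
    (hs : HasDerivWithinAt γ s (Ici 1) v) :
    HasDerivWithinAt (fun w => f (γ w) w) (fu (γ v) v * s + fv (γ v) v) (Ici v) v := by
  have hIci : Ici v ⊆ Ici 1 := Ici_subset_Ici.2 h1
  have A : HasDerivWithinAt (fun w => f (γ w) v) (fu (γ v) v * s) (Ici v) v :=
    HasDerivWithinAt.comp v (h₂ := fun x => f x v) (h := γ) (hu _ _ (h.curve_mem h1))
      (hs.mono hIci)
      fun w hw => (⟨h1, h.mono h1 hw, (h.lt_horizon w (h1.trans hw)).le⟩ : (γ w, v) ∈ region γ U)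
  have B : HasDerivWithinAt (fun w => f (γ w) w - f (γ w) v) (fv (γ v) v) (Ici v) v := by
    rw [hasDerivWithinAt_iff_isLittleO, Asymptotics.isLittleO_iff]
    intro ε hε
    have hcv := hc (γ v, v) (h.curve_mem h1)
    obtain ⟨δ, hδ, hball⟩ := Metric.continuousWithinAt_iff.1 hcv ε hε
    have hγ : ContinuousWithinAt γ (Ici v) v := (h.continuousOn v h1).mono hIci
    have e1 : ∀ᶠ w in 𝓝[Ici v] v, dist (γ w) (γ v) < δ := hγ (Metric.ball_mem_nhds _ hδ)
    have e2 : ∀ᶠ w in 𝓝[Ici v] v, dist w v < δ :=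
      mem_nhdsWithin_of_mem_nhds (Metric.ball_mem_nhds _ hδ)
    filter_upwards [e1, e2, self_mem_nhdsWithin] with w hw1 hw2 hw
    have hw : v ≤ w := hw
    have hmw := h.curve_mem (h1.trans hw)
    have key : ∀ x ∈ Icc v w, |fv (γ w) x - fv (γ v) v| ≤ ε := by
      intro x hx
      have hmx : (γ w, x) ∈ region γ U := h.mem_of_le_v hmw (h1.trans hx.1) hx.2
      have := hball hmx (by
        rw [Prod.dist_eq, max_lt_iff]
        refine ⟨hw1, lt_of_le_of_lt ?_ hw2⟩
        simp only [Real.dist_eq]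
        rw [abs_of_nonneg (by linarith [hx.1]), abs_of_nonneg (by linarith)]
        linarith [hx.2])
      exact this.le
    have := Convex.norm_image_sub_le_of_norm_hasDerivWithin_le
      (f := fun x => f (γ w) x - x * fv (γ v) v) (f' := fun x => fv (γ w) x - 1 * fv (γ v) v)
      (s := Icc v w) (C := ε) (x := v) (y := w) (fun x hx => by
        have hmx : (γ w, x) ∈ region γ U := h.mem_of_le_v hmw (h1.trans hx.1) hx.2
        exact ((hv _ _ hmx).mono fun y hy => h.mem_of_le_v hmw (h1.trans hy.1) hy.2).sub
          ((hasDerivWithinAt_id x _).mul_const _))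
      (fun x hx => by simpa using key x hx) (convex_Icc v w)
      (left_mem_Icc.2 hw) (right_mem_Icc.2 hw)
    convert this using 2
    simp only [smul_eq_mul]
    ring
  refine (A.add B).congr_of_eventuallyEq (Eventually.of_forall fun w => ?_) ?_ <;> simp

end Slices

/-! ### The common framework of the coupled and the uncoupled problem -/

namespace Fields

/-- `(1 - μ) / lam = -4 Ω⁻² nu`, the reciprocal of `κ = lam / (1 - μ)`. -/
noncomputable def invKappa (S : Fields) (u v : ℝ) : ℝ := -(4 / S.Ω u v ^ 2 * S.nu u v)

/-- `1 - μ = 1 - 2 m / r`, expressed through the renormalized mass. -/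
noncomputable def oneSubMu (S : Fields) (e u v : ℝ) : ℝ :=
  1 - 2 * S.renormMass e u v / S.r u v + e ^ 2 / S.r u v ^ 2

/-- The factor `ϖ / r² - e² / r³`; `2 κ` times it is the rate of the redshift. -/
noncomputable def redshift (S : Fields) (e u v : ℝ) : ℝ :=
  S.renormMass e u v / S.r u v ^ 2 - e ^ 2 / S.r u v ^ 3

/-- `ζ / nu`, the derivative of `φ` in the ingoing direction normalized by `r`, which is regular
up to the horizon. -/
noncomputable def ingoing (S : Fields) (u v : ℝ) : ℝ := S.ζ u v / S.nu u v

end Fields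

open Fields

/-- What the coupled system and the wave equation on a fixed background have in common. The
gravitational backreaction of the scalar field on `ϖ` is multiplied by `ε`, which is `1` for the
coupled system and `0` for a fixed background; `E` is an energy of the scalar field that does not
increase along the timelike curve. -/
structure Collapse (γ : ℝ → ℝ) (U R e ε : ℝ) (S : Fields) (E : ℝ → ℝ → ℝ) : Prop where
  curve : IsTimelikeBoundary γ U
  bdry : S.BoundaryConditions γ U R
  regular : S.IsRegular (region γ U)
  radius : S.RadiusEquations (region γ U) e
  wave : S.WaveEquation (region γ U)
  energy : S.MassEquations (region γ U) E
  coupling_nonneg : 0 ≤ ε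
  mass_u : HasPartialU (region γ U) (S.renormMass e)
    (fun u v => ε * -(2 / S.Ω u v ^ 2 * S.lam u v * S.ζ u v ^ 2))
  mass_v : HasPartialV (region γ U) (S.renormMass e)
    (fun u v => ε * -(2 / S.Ω u v ^ 2 * S.nu u v * S.θ u v ^ 2))
  mass_init : 0 ≤ S.renormMass e U 1
  energy_antitone : AntitoneOn (fun v => E (γ v) v) (Ici 1)

namespace Collapse

variable {γ : ℝ → ℝ} {U R e ε : ℝ} {S : Fields} {E : ℝ → ℝ → ℝ} {u v : ℝ}

lemma r_pos (D : Collapse γ U R e ε S E) (hm : (u, v) ∈ region γ U) : 0 < S.r u v :=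
  D.regular.r_pos u v hm

lemma Ω_pos (D : Collapse γ U R e ε S E) (hm : (u, v) ∈ region γ U) : 0 < S.Ω u v :=
  D.regular.Ω_pos u v hm

lemma oneSubMu_eq (D : Collapse γ U R e ε S E) (hm : (u, v) ∈ region γ U) :
    S.oneSubMu e u v = -(4 / S.Ω u v ^ 2 * S.nu u v * S.lam u v) := by
  have h1 := (D.r_pos hm).ne'
  have h2 := (D.Ω_pos hm).ne'
  simp only [oneSubMu, renormMass, hawkingMass]
  field_simp
  ring

lemma oneSubMu_eq_mul (D : Collapse γ U R e ε S E) (hm : (u, v) ∈ region γ U) :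
    S.oneSubMu e u v = S.invKappa u v * S.lam u v := by
  rw [D.oneSubMu_eq hm, invKappa]; ring

lemma contOn_invKappa (D : Collapse γ U R e ε S E) : ContOn (region γ U) S.invKappa :=
  ((continuousOn_const.div (D.regular.Ω_cont.pow 2) fun p hp =>
    (pow_pos (D.Ω_pos (u := p.1) (v := p.2) hp) 2).ne').mul D.regular.nu_cont).neg

lemma nu_neg_of_invKappa_pos (D : Collapse γ U R e ε S E) (hm : (u, v) ∈ region γ U)
    (hn : 0 < S.invKappa u v) : S.nu u v < 0 := by
  have h2 := D.Ω_pos hm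
  have h3 : 0 < 4 / S.Ω u v ^ 2 := by positivity
  by_contra! h
  rw [invKappa] at hn
  nlinarith [mul_nonneg h3.le h]

/-- `∂_u ((1 - μ) / lam) = ε 4 Ω⁻² ζ² / r`, the Raychaudhuri equation in the ingoing direction.
As `Ω` is only continuous, it is derived from the equations for `ϖ` and `lam`, where `lam ≠ 0`. -/
lemma hasDerivAt_invKappa (D : Collapse γ U R e ε S E) (hm : (u, v) ∈ region γ U) {u' x : ℝ}
    (hu' : u' ≤ U) (hl : ∀ y ∈ Ioo u u', 0 < S.lam y v) (hx : x ∈ Ioo u u') :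
    HasDerivAt (fun y => S.invKappa y v) (ε * (4 / S.Ω x v ^ 2) * S.ζ x v ^ 2 / S.r x v) x := by
  have hxU : x ∈ Ioo u U := ⟨hx.1, hx.2.trans_le hu'⟩
  have hmx := mem_of_le_u hm hxU.1.le hxU.2.le
  have hr := (D.r_pos hmx).ne'
  have hΩ := (D.Ω_pos hmx).ne'
  have hlx := (hl x hx).ne'
  have d1 := D.regular.r_u.hasDerivAt hm hxU
  have d2 := D.mass_u.hasDerivAt hm hxU
  have d3 := D.radius.lam_u.hasDerivAt hm hxU
  have d4 := ((((d2.const_mul 2).div d1 hr).const_sub 1).add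
    ((hasDerivAt_const x (e ^ 2)).div (d1.pow 2) (pow_ne_zero 2 hr))).div d3 hlx
  have d5 := d4.congr_of_eventuallyEq (f₁ := fun y => S.invKappa y v) (by
    filter_upwards [Ioo_mem_nhds hx.1 hx.2] with y hy
    have hmy := mem_of_le_u hm hy.1.le (hy.2.le.trans hu')
    have := D.oneSubMu_eq_mul hmy
    have hly := (hl y hy).ne'
    simp only [oneSubMu] at this
    simp only [Pi.add_apply, Pi.div_apply, Pi.pow_apply]
    rw [this]
    field_simp)
  refine d5.congr_deriv ?_
  have hk := D.oneSubMu_eq hmx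
  simp only [oneSubMu] at hk
  simp only [Pi.add_apply, Pi.div_apply, Pi.pow_apply]
  rw [hk]
  field_simp
  ring

/-- `∂_v ((1 - μ) / (-nu)) = -ε 4 Ω⁻² θ² / r`, the Raychaudhuri equation in the outgoing direction:
`4 Ω⁻² lam` does not increase in `v`. -/
lemma lam_div_Ω_sq_le (D : Collapse γ U R e ε S E) (hm : (u, v) ∈ region γ U) {w : ℝ} (hw : 1 ≤ w)
    (hwv : w ≤ v) (hn : ∀ x, (u, x) ∈ region γ U → S.nu u x < 0) :
    4 / S.Ω u v ^ 2 * S.lam u v ≤ 4 / S.Ω u w ^ 2 * S.lam u w := by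
  have hmem : ∀ x ∈ Icc w v, (u, x) ∈ region γ U := fun x hx =>
    D.curve.mem_of_le_v hm (hw.trans hx.1) hx.2
  have heq : ∀ x ∈ Icc w v, 4 / S.Ω u x ^ 2 * S.lam u x =
      -((1 - 2 * S.renormMass e u x / S.r u x + e ^ 2 / S.r u x ^ 2) / S.nu u x) := by
    intro x hx
    have h1 := D.oneSubMu_eq (hmem x hx)
    have h2 := (hn x (hmem x hx)).ne
    simp only [oneSubMu] at h1
    rw [h1]
    field_simp
  rw [heq v ⟨hwv, le_rfl⟩, heq w ⟨le_rfl, hwv⟩]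
  have hd : ∀ x ∈ Ioo w v, HasDerivAt (fun x =>
      -((1 - 2 * S.renormMass e u x / S.r u x + e ^ 2 / S.r u x ^ 2) / S.nu u x))
      (-(ε * (4 / S.Ω u x ^ 2) * S.θ u x ^ 2 / S.r u x)) x := by
    intro x hx
    have hx1 : x ∈ Ioo 1 v := ⟨hw.trans_lt hx.1, hx.2⟩
    have hmx := hmem x ⟨hx.1.le, hx.2.le⟩
    have hr := (D.r_pos hmx).ne'
    have hΩ := (D.Ω_pos hmx).ne'
    have hnx := (hn x hmx).ne
    have d1 := D.regular.r_v.hasDerivAt D.curve hm hx1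
    have d2 := D.mass_v.hasDerivAt D.curve hm hx1
    have d3 := D.radius.nu_v.hasDerivAt D.curve hm hx1
    have d4 := (((((d2.const_mul 2).div d1 hr).const_sub 1).add
      ((hasDerivAt_const x (e ^ 2)).div (d1.pow 2) (pow_ne_zero 2 hr))).div d3 hnx).neg
    refine d4.congr_deriv ?_
    have hk := D.oneSubMu_eq hmx
    simp only [oneSubMu] at hk
    simp only [Pi.add_apply, Pi.div_apply, Pi.pow_apply]
    rw [hk]
    field_simp
    ring
  refine le_of_hasDerivAt_nonpos (f := fun x =>
    -((1 - 2 * S.renormMass e u x / S.r u x + e ^ 2 / S.r u x ^ 2) / S.nu u x)) hwv ?_ hd ?_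
  · have hsub : Icc w v ⊆ Icc 1 v := Icc_subset_Icc_left hw
    have hr := (D.regular.r_cont.slice_v D.curve hm).mono hsub
    refine (((continuousOn_const.sub ((continuousOn_const.mul
      ((D.mass_v.continuousOn D.curve hm).mono hsub)).div hr ?_)).add
      (continuousOn_const.div (hr.pow 2) ?_)).div
      ((D.regular.nu_cont.slice_v D.curve hm).mono hsub) ?_).neg
    · exact fun x hx => (D.r_pos (hmem x hx)).ne'
    · exact fun x hx => pow_ne_zero 2 (D.r_pos (hmem x hx)).ne'
    · exact fun x hx => (hn x (hmem x hx)).ne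
  · intro x hx
    have hr := D.r_pos (hmem x ⟨hx.1.le, hx.2.le⟩)
    have := D.coupling_nonneg
    rw [neg_nonpos]
    positivity

lemma invKappa_mono (D : Collapse γ U R e ε S E) (hm : (u, v) ∈ region γ U) {u' : ℝ}
    (h1 : u ≤ u') (hu' : u' ≤ U) (hl : ∀ y ∈ Ioo u u', 0 < S.lam y v) :
    S.invKappa u v ≤ S.invKappa u' v := by
  refine le_of_hasDerivAt_nonneg h1 ((D.contOn_invKappa.slice_u hm).mono (Icc_subset_Icc_right hu'))
    (fun x hx => D.hasDerivAt_invKappa hm hu' hl hx) fun x hx => ?_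
  have := D.r_pos (mem_of_le_u hm hx.1.le (hx.2.le.trans hu'))
  have := D.coupling_nonneg
  positivity

/-! ### Signs of the null derivatives of the radius -/

lemma oneSubMu_curve (D : Collapse γ U R e ε S E) (hv : 1 ≤ v) :
    S.oneSubMu e (γ v) v = 1 - 2 * S.hawkingMass (γ v) v / R := by
  have h1 := (D.r_pos (D.curve.curve_mem hv)).ne'
  rw [← D.bdry.r_bdry v hv]
  simp only [oneSubMu, renormMass]
  field_simp
  ring

lemma invKappa_curve (D : Collapse γ U R e ε S E) (hv : 1 ≤ v) :
    S.invKappa (γ v) v = S.oneSubMu e (γ v) v := by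
  rw [D.oneSubMu_eq_mul (D.curve.curve_mem hv), D.bdry.lam_bdry v hv, mul_one]

lemma R_pos (D : Collapse γ U R e ε S E) : 0 < R := by
  rw [← D.bdry.r_bdry 1 le_rfl]
  exact D.r_pos (D.curve.curve_mem le_rfl)

lemma exists_le_invKappa_curve (D : Collapse γ U R e ε S E) :
    ∃ b, 0 < b ∧ ∀ v, 1 ≤ v → b ≤ S.invKappa (γ v) v := by
  obtain ⟨M₀, h0, hM⟩ := D.bdry.mass_bdry
  have hR := D.R_pos
  refine ⟨1 - M₀ / R, by rw [sub_pos, div_lt_one hR]; exact h0, fun v hv => ?_⟩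
  rw [D.invKappa_curve hv, D.oneSubMu_curve hv]
  gcongr
  exact hM v hv

/-- If `nu < 0` on an outgoing ray before the horizon, then `lam > 0` there: `4 Ω⁻² lam` does not
increase towards the intersection with the timelike curve, where it is positive. -/
lemma lam_pos_of_nu_neg (D : Collapse γ U R e ε S E) (hm : (u, v) ∈ region γ U) (hu : u < U)
    (hn : ∀ x, (u, x) ∈ region γ U → S.nu u x < 0) : 0 < S.lam u v := by
  obtain ⟨V, hV, rfl⟩ := D.curve.exists_eq ((D.curve.one_le hm.1).trans hm.2.1) hu
  have hV' := D.curve.curve_mem hV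
  have h1 := D.lam_div_Ω_sq_le hV' hm.1 (D.curve.le_of_le hm.1 hV hm.2.1) hn
  have h2 := D.Ω_pos hm
  have h3 := D.Ω_pos hV'
  rw [D.bdry.lam_bdry V hV] at h1
  have h4 : 0 < 4 / S.Ω (γ V) v ^ 2 * S.lam (γ V) v := lt_of_lt_of_le (by positivity) h1
  exact (pos_iff_pos_of_mul_pos h4).1 (by positivity)

/-- The radius decreases towards the horizon along ingoing rays. At a point
with the least `u` at which `nu ≥ 0`, the monotonicity of `(1 - μ) / lam = -4 Ω⁻² nu` in `u`
bounds `-nu` below by its positive value on the timelike curve. -/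
lemma nu_neg_of_lt (D : Collapse γ U R e ε S E) (hm : (u, v) ∈ region γ U) (hu : u < U) :
    S.nu u v < 0 := by
  obtain ⟨b, hb, hbv⟩ := D.exists_le_invKappa_curve
  by_contra! hneg
  obtain ⟨V, hV, hVu⟩ := D.curve.exists_eq ((D.curve.one_le hm.1).trans hm.2.1) hu
  have hK : IsCompact {p : ℝ × ℝ | p ∈ {p : ℝ × ℝ | p ∈ region γ U ∧ p.2 ≤ V} ∧
      0 ≤ S.nu p.1 p.2} := by
    have hc := D.curve.isCompact_inter V
    refine hc.of_isClosed_subset (hc.isClosed.isClosed_le continuousOn_const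
      (D.regular.nu_cont.mono fun p hp => hp.1)) fun p hp => hp.1
  obtain ⟨⟨u₀, v₀⟩, ⟨⟨hm0, hv0⟩, hn0⟩, hmin⟩ := hK.exists_isMinOn (f := Prod.fst)
    ⟨(u, v), ⟨hm, D.curve.le_of_le hm.1 hV (hVu ▸ hm.2.1)⟩, hneg⟩ continuousOn_fst
  have hle : u₀ ≤ u := hmin (show (u, v) ∈ _ from
    ⟨⟨hm, D.curve.le_of_le hm.1 hV (hVu ▸ hm.2.1)⟩, hneg⟩)
  have hnu : ∀ y, y < u₀ → ∀ x, (y, x) ∈ region γ U → S.nu y x < 0 := by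
    intro y hy x hx
    by_contra! h
    have : u₀ ≤ y := hmin (show (y, x) ∈ _ from
      ⟨⟨hx, D.curve.le_of_le hx.1 hV (hx.2.1.trans (hVu ▸ (hy.le.trans hle)))⟩, h⟩)
    linarith
  have hv0 := hm0.1
  have h1 := D.invKappa_mono (D.curve.curve_mem hv0) hm0.2.1 hm0.2.2 fun y hy =>
    D.lam_pos_of_nu_neg (mem_of_le_u (D.curve.curve_mem hv0) hy.1.le (hy.2.le.trans hm0.2.2))
      (hy.2.trans_le (hle.trans hu.le)) (hnu y hy.2)
  have h2 := D.nu_neg_of_invKappa_pos hm0 (hb.trans_le ((hbv v₀ hv0).trans h1))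
  exact absurd hn0 (not_le.2 h2)

lemma lam_pos (D : Collapse γ U R e ε S E) (hm : (u, v) ∈ region γ U) (hu : u < U) :
    0 < S.lam u v :=
  D.lam_pos_of_nu_neg hm hu fun _ hx => D.nu_neg_of_lt hx hu

lemma invKappa_curve_le (D : Collapse γ U R e ε S E) (hm : (u, v) ∈ region γ U) :
    S.invKappa (γ v) v ≤ S.invKappa u v :=
  D.invKappa_mono (D.curve.curve_mem hm.1) hm.2.1 hm.2.2 fun _ hy =>
    D.lam_pos (mem_of_le_u (D.curve.curve_mem hm.1) hy.1.le (hy.2.le.trans hm.2.2))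
      (hy.2.trans_le hm.2.2)

lemma exists_le_invKappa (D : Collapse γ U R e ε S E) :
    ∃ b, 0 < b ∧ ∀ u v, (u, v) ∈ region γ U → b ≤ S.invKappa u v := by
  obtain ⟨b, hb, hbv⟩ := D.exists_le_invKappa_curve
  exact ⟨b, hb, fun u v hm => (hbv v hm.1).trans (D.invKappa_curve_le hm)⟩

lemma invKappa_pos (D : Collapse γ U R e ε S E) (hm : (u, v) ∈ region γ U) :
    0 < S.invKappa u v := by
  obtain ⟨b, hb, hbv⟩ := D.exists_le_invKappa
  exact hb.trans_le (hbv u v hm)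

lemma nu_neg (D : Collapse γ U R e ε S E) (hm : (u, v) ∈ region γ U) : S.nu u v < 0 :=
  D.nu_neg_of_invKappa_pos hm (D.invKappa_pos hm)

lemma lam_nonneg (D : Collapse γ U R e ε S E) (hm : (u, v) ∈ region γ U) : 0 ≤ S.lam u v := by
  rcases hm.2.2.lt_or_eq with hu | hu
  · exact (D.lam_pos hm hu).le
  have hu : u = U := hu
  subst hu
  have hlt := D.curve.lt_horizon v hm.1
  have hc : ContinuousOn (fun x => S.lam x v) (Icc (γ v) u) :=
    D.regular.lam_cont.slice_u (D.curve.curve_mem hm.1)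
  have := ContinuousWithinAt.closure_le (s := Ico (γ v) u) (x := u)
    (f := fun _ => (0 : ℝ)) (g := fun x => S.lam x v)
    (by rw [closure_Ico hlt.ne]; exact right_mem_Icc.2 hlt.le)
    continuousWithinAt_const ((hc u (right_mem_Icc.2 hlt.le)).mono Ico_subset_Icc_self)
    (fun y hy => (D.lam_pos (mem_of_le_u (D.curve.curve_mem hm.1) hy.1 hy.2.le) hy.2).le)
  exact this

lemma oneSubMu_nonneg (D : Collapse γ U R e ε S E) (hm : (u, v) ∈ region γ U) :
    0 ≤ S.oneSubMu e u v := by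
  rw [D.oneSubMu_eq_mul hm]
  exact mul_nonneg (D.invKappa_pos hm).le (D.lam_nonneg hm)

/-! ### Monotonicity of the mass and of the energy, and uniform bounds -/

lemma energy_u_nonpos (D : Collapse γ U R e ε S E) (hm : (u, v) ∈ region γ U) :
    -(2 / S.Ω u v ^ 2 * S.lam u v * S.ζ u v ^ 2) ≤ 0 := by
  have := D.lam_nonneg hm
  rw [neg_nonpos]
  positivity

lemma energy_v_eq (S : Fields) (u v : ℝ) :
    -(2 / S.Ω u v ^ 2 * S.nu u v * S.θ u v ^ 2) = S.invKappa u v * S.θ u v ^ 2 / 2 := by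
  rw [invKappa]; ring

lemma energy_v_nonneg (D : Collapse γ U R e ε S E) (hm : (u, v) ∈ region γ U) :
    0 ≤ -(2 / S.Ω u v ^ 2 * S.nu u v * S.θ u v ^ 2) := by
  have := D.invKappa_pos hm
  rw [energy_v_eq]
  positivity

lemma energy_le_u (D : Collapse γ U R e ε S E) (hm : (u, v) ∈ region γ U) {u' : ℝ}
    (h1 : u ≤ u') (h2 : u' ≤ U) : E u' v ≤ E u v :=
  D.energy.w_u.le hm h1 h2 fun _ hx =>
    D.energy_u_nonpos (mem_of_le_u hm hx.1.le (hx.2.le.trans h2))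

lemma energy_le_v (D : Collapse γ U R e ε S E) (hm : (u, v) ∈ region γ U) {w : ℝ}
    (h1 : 1 ≤ w) (h2 : w ≤ v) : E u w ≤ E u v :=
  D.energy.w_v.le D.curve hm h1 h2 fun _ hx =>
    D.energy_v_nonneg (D.curve.mem_of_le_v hm (h1.trans hx.1.le) hx.2.le)

lemma mass_le_u (D : Collapse γ U R e ε S E) (hm : (u, v) ∈ region γ U) {u' : ℝ}
    (h1 : u ≤ u') (h2 : u' ≤ U) : S.renormMass e u' v ≤ S.renormMass e u v :=
  D.mass_u.le hm h1 h2 fun _ hx => mul_nonpos_of_nonneg_of_nonpos D.coupling_nonneg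
    (D.energy_u_nonpos (mem_of_le_u hm hx.1.le (hx.2.le.trans h2)))

lemma mass_le_v (D : Collapse γ U R e ε S E) (hm : (u, v) ∈ region γ U) {w : ℝ}
    (h1 : 1 ≤ w) (h2 : w ≤ v) : S.renormMass e u w ≤ S.renormMass e u v :=
  D.mass_v.le D.curve hm h1 h2 fun _ hx => mul_nonneg D.coupling_nonneg
    (D.energy_v_nonneg (D.curve.mem_of_le_v hm (h1.trans hx.1.le) hx.2.le))

lemma horizon_mass_le (D : Collapse γ U R e ε S E) (hm : (u, v) ∈ region γ U) {w : ℝ}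
    (h1 : 1 ≤ w) (h2 : w ≤ v) : S.renormMass e U w ≤ S.renormMass e u v :=
  (D.mass_le_v (D.curve.horizon_mem hm.1) h1 h2).trans (D.mass_le_u hm hm.2.2 le_rfl)

lemma mass_nonneg (D : Collapse γ U R e ε S E) (hm : (u, v) ∈ region γ U) :
    0 ≤ S.renormMass e u v :=
  D.mass_init.trans (D.horizon_mass_le hm le_rfl hm.1)

lemma horizon_energy_le (D : Collapse γ U R e ε S E) (hm : (u, v) ∈ region γ U) {w : ℝ}
    (h1 : 1 ≤ w) (h2 : w ≤ v) : E U w ≤ E u v :=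
  (D.energy_le_v (D.curve.horizon_mem hm.1) h1 h2).trans (D.energy_le_u hm hm.2.2 le_rfl)

lemma energy_le_curve (D : Collapse γ U R e ε S E) (hm : (u, v) ∈ region γ U) {w : ℝ}
    (h1 : 1 ≤ w) (h2 : w ≤ v) : E u v ≤ E (γ w) w :=
  (D.energy_le_u (D.curve.curve_mem hm.1) hm.2.1 hm.2.2).trans
    (D.energy_antitone h1 (h1.trans h2) h2)

lemma r_le (D : Collapse γ U R e ε S E) (hm : (u, v) ∈ region γ U) : S.r u v ≤ R := by
  rw [← D.bdry.r_bdry v hm.1]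
  exact D.regular.r_u.le (D.curve.curve_mem hm.1) hm.2.1 hm.2.2 fun x hx =>
    (D.nu_neg (mem_of_le_u (D.curve.curve_mem hm.1) hx.1.le (hx.2.le.trans hm.2.2))).le

lemma exists_lt_r (D : Collapse γ U R e ε S E) :
    ∃ c, 0 < c ∧ ∀ u v, (u, v) ∈ region γ U → c < S.r u v := by
  obtain ⟨c, hc, hr⟩ := D.bdry.r_init
  refine ⟨c, hc, fun u v hm => (hr u ((D.curve.one_le hm.1).trans hm.2.1) hm.2.2).trans_le ?_⟩
  exact D.regular.r_v.le D.curve hm le_rfl hm.1 fun x hx =>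
    D.lam_nonneg (D.curve.mem_of_le_v hm hx.1.le hx.2.le)

lemma exists_oneSubMu_le (D : Collapse γ U R e ε S E) :
    ∃ H, 0 < H ∧ ∀ u v, (u, v) ∈ region γ U → S.oneSubMu e u v ≤ H := by
  obtain ⟨c, hc, hr⟩ := D.exists_lt_r
  refine ⟨1 + e ^ 2 / c ^ 2, by positivity, fun u v hm => ?_⟩
  have h1 := D.mass_nonneg hm
  have h2 := D.r_pos hm
  have h3 : e ^ 2 / S.r u v ^ 2 ≤ e ^ 2 / c ^ 2 := by
    gcongr
    exact (hr u v hm).le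
  have h4 : 0 ≤ 2 * S.renormMass e u v / S.r u v := by positivity
  rw [oneSubMu]
  linarith

lemma exists_lam_le (D : Collapse γ U R e ε S E) :
    ∃ L, 0 < L ∧ ∀ u v, (u, v) ∈ region γ U → S.lam u v ≤ L := by
  obtain ⟨H, hH, hh⟩ := D.exists_oneSubMu_le
  obtain ⟨b, hb, hbk⟩ := D.exists_le_invKappa
  refine ⟨H / b, by positivity, fun u v hm => ?_⟩
  rw [le_div_iff₀ hb, mul_comm]
  have h1 := hh u v hm
  rw [D.oneSubMu_eq_mul hm] at h1
  exact (mul_le_mul_of_nonneg_right (hbk u v hm) (D.lam_nonneg hm)).trans h1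

/-- The area radius stays bounded along the horizon, so `lam` has no positive lower bound there. -/
lemma exists_horizon_lam_lt (D : Collapse γ U R e ε S E) {a w : ℝ} (ha : 0 < a) (hw : 1 ≤ w) :
    ∃ v, w ≤ v ∧ S.lam U v < a := by
  by_contra! h
  have hv : w ≤ w + R / a := by linarith [div_pos D.R_pos ha]
  have hm := D.curve.horizon_mem (hw.trans hv)
  have h1 := le_of_hasDerivAt_nonneg (f := fun x => S.r U x - x * a)
    (f' := fun x => S.lam U x - 1 * a) hv
    (((D.regular.r_v.continuousOn D.curve hm).mono (Icc_subset_Icc_left hw)).sub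
      (continuousOn_id.mul continuousOn_const))
    (fun x hx => (D.regular.r_v.hasDerivAt D.curve hm ⟨hw.trans_lt hx.1, hx.2⟩).sub
      ((hasDerivAt_id x).mul_const a))
    (fun x hx => by linarith [h x hx.1.le])
  have h2 := D.r_le hm
  have h3 := D.r_pos (D.curve.horizon_mem hw)
  have h4 : (w + R / a) * a = w * a + R := by field_simp
  simp only [h4] at h1
  linarith

/-! ### Positivity of the redshift factor -/

lemma redshift_eq (D : Collapse γ U R e ε S E) (hm : (u, v) ∈ region γ U) :
    S.redshift e u v = (S.renormMass e u v * S.r u v - e ^ 2) / S.r u v ^ 3 := by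
  have := (D.r_pos hm).ne'
  rw [redshift]
  field_simp

/-- Once the mass of the horizon exceeds `|e|`, the radius `|e|` does not occur, since `1 - μ`
would be negative there. -/
lemma r_ne_abs (D : Collapse γ U R e ε S E) {v₀ : ℝ} (h0 : 1 ≤ v₀)
    (hM : |e| < S.renormMass e U v₀) (hm : (u, v) ∈ region γ U) (hv : v₀ ≤ v) :
    S.r u v ≠ |e| := by
  intro hr
  have h1 := D.oneSubMu_nonneg hm
  have h2 := D.horizon_mass_le hm h0 hv
  have h3 := D.r_pos hm
  have h4 : e ^ 2 = S.r u v ^ 2 := by rw [hr, sq_abs]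
  rw [oneSubMu, h4, div_self (by positivity)] at h1
  have h5 : 1 < S.renormMass e u v / S.r u v := by
    rw [one_lt_div h3]
    linarith
  rw [mul_div_assoc] at h1
  linarith

lemma abs_lt_r_of_lt (D : Collapse γ U R e ε S E) {v₀ : ℝ} (h0 : 1 ≤ v₀)
    (hM : |e| < S.renormMass e U v₀) (hR : |e| < R) (hm : (u, v) ∈ region γ U) (hv : v₀ ≤ v) :
    |e| < S.r u v := by
  by_contra! h
  have hmc := D.curve.curve_mem hm.1
  obtain ⟨x, hx, hxe⟩ := intermediate_value_Icc' hm.2.1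
    ((D.regular.r_cont.slice_u hmc).mono (Icc_subset_Icc_right hm.2.2))
    (show |e| ∈ Icc (S.r u v) (S.r (γ v) v) from ⟨h, by rw [D.bdry.r_bdry v hm.1]; exact hR.le⟩)
  exact D.r_ne_abs h0 hM (mem_of_le_u hmc hx.1 (hx.2.trans hm.2.2)) hv hxe

/-- The timelike curve lies outside the radius `|e|`. Otherwise `1 - μ ≥ 0` forces gravity to be
repulsive in the whole region: `lam` increases towards the horizon, so
`lam ≥ 1` on the horizon and its radius is unbounded. -/
lemma abs_lt_R (D : Collapse γ U R e ε S E) : |e| < R := by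
  by_contra! h
  obtain ⟨v, hv1, hlt⟩ := D.exists_horizon_lam_lt one_pos le_rfl
  have hmc := D.curve.curve_mem hv1
  have hmU := D.curve.horizon_mem hv1
  have := le_of_hasDerivAt_nonneg (D.curve.lt_horizon v hv1).le
    (D.radius.lam_u.continuousOn hmc) (fun x hx => D.radius.lam_u.hasDerivAt hmc hx)
    (fun x hx => by
      have hmx := mem_of_le_u hmc hx.1.le hx.2.le
      have h1 := D.redshift_eq hmx
      rw [redshift] at h1
      rw [h1]
      have hr := D.r_pos hmx
      have hre := (D.r_le hmx).trans h
      have h2 := D.oneSubMu_nonneg hmx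
      have h3 : S.oneSubMu e x v * S.r x v ^ 2 =
          S.r x v ^ 2 - 2 * S.renormMass e x v * S.r x v + e ^ 2 := by
        rw [oneSubMu]; field_simp
      have h4 : 0 ≤ S.oneSubMu e x v * S.r x v ^ 2 := by positivity
      have h5 : S.r x v ^ 2 ≤ e ^ 2 := by
        rw [← sq_abs e]
        gcongr
      have h6 : (S.renormMass e x v * S.r x v - e ^ 2) / S.r x v ^ 3 ≤ 0 :=
        div_nonpos_of_nonpos_of_nonneg (by nlinarith) (by positivity)
      have h7 : 0 ≤ S.Ω x v ^ 2 / 2 := by positivity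
      nlinarith)
  have h8 := D.bdry.lam_bdry v hv1
  linarith

lemma exists_le_redshift (D : Collapse γ U R e ε S E) {v₀ : ℝ} (h0 : 1 ≤ v₀)
    (hM : |e| < S.renormMass e U v₀) :
    ∃ b, 0 < b ∧ ∀ u v, (u, v) ∈ region γ U → v₀ ≤ v → b ≤ S.redshift e u v := by
  obtain ⟨c, hc, hr⟩ := D.exists_lt_r
  have hR := D.R_pos
  have hM' := sub_pos.2 hM
  refine ⟨(S.renormMass e U v₀ - |e|) * c / R ^ 3, by positivity, fun u v hm hv => ?_⟩
  rw [D.redshift_eq hm]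
  have h1 := D.abs_lt_r_of_lt h0 hM D.abs_lt_R hm hv
  have h2 := D.horizon_mass_le hm h0 hv
  have h3 := hr u v hm
  have h4 := D.r_pos hm
  have h5 : (S.renormMass e U v₀ - |e|) * c ≤ S.renormMass e u v * S.r u v - e ^ 2 := by
    rw [← sq_abs e]
    nlinarith [abs_nonneg e, mul_le_mul_of_nonneg_left h3.le hM'.le,
      mul_le_mul_of_nonneg_right h2 h4.le, mul_le_mul_of_nonneg_left h1.le (abs_nonneg e)]
  have h6 : 0 ≤ (S.renormMass e U v₀ - |e|) * c := by positivity
  exact div_le_div₀ (h6.trans h5) h5 (by positivity) (by gcongr; exact D.r_le hm)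

/-! ### The redshift estimate for the ingoing derivative -/

lemma half_Ω_sq (D : Collapse γ U R e ε S E) (hm : (u, v) ∈ region γ U) :
    S.Ω u v ^ 2 / 2 = -(2 * S.nu u v / S.invKappa u v) := by
  have h1 := (D.Ω_pos hm).ne'
  have h2 := (D.nu_neg hm).ne
  rw [invKappa]
  field_simp
  ring

lemma contOn_ingoing (D : Collapse γ U R e ε S E) : ContOn (region γ U) S.ingoing :=
  D.regular.ζ_cont.div D.regular.nu_cont fun p hp => (D.nu_neg (u := p.1) (v := p.2) hp).ne

/-- `∂_v (ζ / nu) = -θ / r - 2 κ (ϖ / r² - e² / r³) ζ / nu`, stated for the square. -/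
lemma hasDerivAt_ingoing_sq (D : Collapse γ U R e ε S E) (hm : (u, v) ∈ region γ U) {x : ℝ}
    (hx : x ∈ Ioo 1 v) :
    HasDerivAt (fun y => S.ingoing u y ^ 2)
      (2 * S.ingoing u x * (-(S.θ u x / S.r u x) -
        2 * S.redshift e u x / S.invKappa u x * S.ingoing u x)) x := by
  have hmx := D.curve.mem_of_le_v hm hx.1.le hx.2.le
  have hr := (D.r_pos hmx).ne'
  have hn := (D.nu_neg hmx).ne
  have hk := (D.invKappa_pos hmx).ne'
  have d1 := D.wave.ζ_v.hasDerivAt D.curve hm hx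
  have d2 := D.radius.nu_v.hasDerivAt D.curve hm hx
  refine ((d1.div d2 hn).pow 2).congr_deriv ?_
  rw [D.half_Ω_sq hmx]
  simp only [ingoing, redshift, Pi.div_apply, Nat.cast_ofNat, Nat.add_one_sub_one, pow_one]
  field_simp

/-- The redshift inequality `∂_v (ζ / nu)² ≤ -2 κ (ϖ / r² - e² / r³) (ζ / nu)² + C ∂_v E`: the
outgoing derivative enters only through the energy flux, whatever the size of `κ`. -/
lemma ingoing_sq_deriv_le (D : Collapse γ U R e ε S E) (hm : (u, v) ∈ region γ U) {b c : ℝ}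
    (hb : 0 < b) (hc : 0 < c) (hbB : b ≤ S.redshift e u v) (hcr : c ≤ S.r u v) :
    2 * S.ingoing u v * (-(S.θ u v / S.r u v) -
        2 * S.redshift e u v / S.invKappa u v * S.ingoing u v) ≤
      -(2 * S.redshift e u v / S.invKappa u v * S.ingoing u v ^ 2) +
        1 / (b * c ^ 2) * -(2 / S.Ω u v ^ 2 * S.nu u v * S.θ u v ^ 2) := by
  rw [energy_v_eq]
  have hk := D.invKappa_pos hm
  have hr := D.r_pos hm
  have hB := hb.trans_le hbB
  generalize S.redshift e u v = B at *
  generalize S.invKappa u v = k at *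
  generalize S.r u v = r at *
  generalize S.θ u v = θ at *
  generalize S.ingoing u v = Z at *
  have h1 : 0 ≤ (2 * B * Z + k * θ / r) ^ 2 / (2 * B * k) := by positivity
  have h2 : (2 * B * Z + k * θ / r) ^ 2 / (2 * B * k) =
      2 * B / k * Z ^ 2 + 2 * Z * (θ / r) + k * θ ^ 2 / (2 * (B * r ^ 2)) := by
    field_simp
    ring
  have h3 : k * θ ^ 2 / (2 * (B * r ^ 2)) ≤ k * θ ^ 2 / (2 * (b * c ^ 2)) := by gcongr
  have h4 : 1 / (b * c ^ 2) * (k * θ ^ 2 / 2) = k * θ ^ 2 / (2 * (b * c ^ 2)) := by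
    field_simp
  rw [h4]
  have h5 : 2 * Z * (-(θ / r) - 2 * B / k * Z) =
      -(2 * Z * (θ / r)) - 2 * (2 * B / k * Z ^ 2) := by ring
  linarith

lemma exists_abs_le_of_le (D : Collapse γ U R e ε S E) {f : ℝ → ℝ → ℝ}
    (hf : ContOn (region γ U) f) (w : ℝ) :
    ∃ C, ∀ u v, (u, v) ∈ region γ U → v ≤ w → |f u v| ≤ C := by
  obtain ⟨C, hC⟩ := (D.curve.isCompact_inter w).exists_bound_of_continuousOn
    (hf.mono fun p hp => hp.1)
  exact ⟨C, fun u v hm hv => hC (u, v) ⟨hm, hv⟩⟩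

/-- `ζ / nu` is bounded: by the redshift inequality, `(ζ / nu)²` grows along an outgoing ray at
most by a multiple of the energy flux through it. -/
lemma exists_ingoing_sq_le (D : Collapse γ U R e ε S E) {v₀ : ℝ} (h0 : 1 ≤ v₀)
    (hM : |e| < S.renormMass e U v₀) :
    ∃ A, 0 ≤ A ∧ ∀ u v, (u, v) ∈ region γ U → v₀ ≤ v → S.ingoing u v ^ 2 ≤ A := by
  obtain ⟨b, hb, hbB⟩ := D.exists_le_redshift h0 hM
  obtain ⟨c, hc, hr⟩ := D.exists_lt_r
  obtain ⟨A, hA⟩ := D.exists_abs_le_of_le D.contOn_ingoing v₀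
  have hF := D.horizon_energy_le (D.curve.curve_mem h0) h0 le_rfl
  have hF' := sub_nonneg.2 hF
  refine ⟨A ^ 2 + 1 / (b * c ^ 2) * (E (γ v₀) v₀ - E U v₀), by positivity, fun u v hm hv => ?_⟩
  have hsub : Icc v₀ v ⊆ Icc 1 v := Icc_subset_Icc_left h0
  have h1 := le_of_hasDerivAt_nonpos (f := fun x => S.ingoing u x ^ 2 - 1 / (b * c ^ 2) * E u x) hv
    ((((D.contOn_ingoing.slice_v D.curve hm).mono hsub).pow 2).sub
      (continuousOn_const.mul ((D.energy.w_v.continuousOn D.curve hm).mono hsub)))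
    (fun x hx => (D.hasDerivAt_ingoing_sq hm ⟨h0.trans_lt hx.1, hx.2⟩).sub
      ((D.energy.w_v.hasDerivAt D.curve hm ⟨h0.trans_lt hx.1, hx.2⟩).const_mul _))
    (fun x hx => by
      have hmx := D.curve.mem_of_le_v hm (h0.trans hx.1.le) hx.2.le
      have h2 := D.ingoing_sq_deriv_le hmx hb hc (hbB _ _ hmx hx.1.le) (hr _ _ hmx).le
      have h3 := hb.trans_le (hbB _ _ hmx hx.1.le)
      have h4 := D.invKappa_pos hmx
      have h5 : 0 ≤ 2 * S.redshift e u x / S.invKappa u x * S.ingoing u x ^ 2 := by positivity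
      linarith)
  have hm0 := D.curve.mem_of_le_v hm h0 hv
  have h2 := D.horizon_energy_le hm0 h0 le_rfl
  have h3 := D.energy_le_curve hm h0 hv
  have h4 : S.ingoing u v₀ ^ 2 ≤ A ^ 2 := by
    rw [← sq_abs (S.ingoing u v₀)]
    gcongr
    exact hA u v₀ hm0 le_rfl
  have h5 : 1 / (b * c ^ 2) * (E u v - E u v₀) ≤ 1 / (b * c ^ 2) * (E (γ v₀) v₀ - E U v₀) := by
    gcongr
  linarith [h1]

/-- Where `(ζ / nu)² ≤ A` on an ingoing segment, `exp (ε A r / c) (1 - μ) / lam` does not increase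
towards the horizon. -/
lemma invKappa_mul_exp_le (D : Collapse γ U R e ε S E) (hm : (u, v) ∈ region γ U) {A c : ℝ}
    (hA : 0 ≤ A) (hc : 0 < c) (hcr : ∀ x ∈ Ioo u U, c ≤ S.r x v)
    (hZ : ∀ x ∈ Ioo u U, S.ingoing x v ^ 2 ≤ A) :
    S.invKappa U v * Real.exp (ε * A / c * S.r U v) ≤
      S.invKappa u v * Real.exp (ε * A / c * S.r u v) := by
  refine le_of_hasDerivAt_nonpos
    (f := fun x => S.invKappa x v * Real.exp (ε * A / c * S.r x v)) hm.2.2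
    ((D.contOn_invKappa.slice_u hm).mul
      (Real.continuous_exp.comp_continuousOn (continuousOn_const.mul (D.regular.r_u.continuousOn hm))))
    (fun x hx => (D.hasDerivAt_invKappa hm le_rfl (fun y hy =>
      D.lam_pos (mem_of_le_u hm hy.1.le hy.2.le) hy.2) hx).mul
      ((D.regular.r_u.hasDerivAt hm hx).const_mul _).exp) fun x hx => ?_
  have hmx := mem_of_le_u hm hx.1.le hx.2.le
  have hn := D.nu_neg hmx
  have hr := D.r_pos hmx
  have hΩ := D.Ω_pos hmx
  have hk := D.invKappa_pos hmx
  have hε := D.coupling_nonneg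
  have e1 : ε * (4 / S.Ω x v ^ 2) * S.ζ x v ^ 2 / S.r x v =
      S.invKappa x v * (ε * (-S.nu x v) * (S.ingoing x v ^ 2 / S.r x v)) := by
    rw [invKappa, ingoing]
    have := hn.ne
    field_simp
  have e2 : S.ingoing x v ^ 2 / S.r x v ≤ A / c := by
    gcongr
    · exact hZ x hx
    · exact hcr x hx
  have e3 : ε * (-S.nu x v) * (S.ingoing x v ^ 2 / S.r x v) ≤ ε * (-S.nu x v) * (A / c) := by
    have : 0 ≤ -S.nu x v := by linarith
    gcongr
  have e4 : ε * (4 / S.Ω x v ^ 2) * S.ζ x v ^ 2 / S.r x v * Real.exp (ε * A / c * S.r x v) +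
      S.invKappa x v * (Real.exp (ε * A / c * S.r x v) * (ε * A / c * S.nu x v)) =
      S.invKappa x v * Real.exp (ε * A / c * S.r x v) *
        (ε * (-S.nu x v) * (S.ingoing x v ^ 2 / S.r x v) - ε * (-S.nu x v) * (A / c)) := by
    rw [e1]; ring
  rw [e4]
  exact mul_nonpos_of_nonneg_of_nonpos (by positivity) (by linarith)

/-- If `ζ / nu` is bounded at late times then so is `1 / κ` on the horizon, where it is largest on
each ingoing ray. -/
lemma exists_invKappa_le (D : Collapse γ U R e ε S E) {v₀ A : ℝ} (hA : 0 ≤ A)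
    (hZ : ∀ u v, (u, v) ∈ region γ U → v₀ ≤ v → S.ingoing u v ^ 2 ≤ A) :
    ∃ K, 0 < K ∧ ∀ v, 1 ≤ v → v₀ ≤ v → S.invKappa U v ≤ K := by
  obtain ⟨c, hc, hr⟩ := D.exists_lt_r
  obtain ⟨H, hH, hh⟩ := D.exists_oneSubMu_le
  refine ⟨H * Real.exp (ε * A / c * R), by positivity, fun v h1 h2 => ?_⟩
  have hm := D.curve.curve_mem h1
  have h3 := D.invKappa_mul_exp_le hm hA hc
    (fun x hx => (hr _ _ (mem_of_le_u hm hx.1.le hx.2.le)).le)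
    (fun x hx => hZ _ _ (mem_of_le_u hm hx.1.le hx.2.le) h2)
  have h4 := D.invKappa_pos (D.curve.horizon_mem h1)
  have h5 := D.r_pos (D.curve.horizon_mem h1)
  have hε := D.coupling_nonneg
  have h6 : 1 ≤ Real.exp (ε * A / c * S.r U v) := Real.one_le_exp (by positivity)
  rw [D.bdry.r_bdry v h1, D.invKappa_curve h1] at h3
  calc S.invKappa U v ≤ S.invKappa U v * Real.exp (ε * A / c * S.r U v) :=
        le_mul_of_one_le_right h4.le h6
    _ ≤ _ := h3
    _ ≤ _ := by
        gcongr
        exact hh _ _ hm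

lemma invKappa_le_horizon (D : Collapse γ U R e ε S E) (hm : (u, v) ∈ region γ U) :
    S.invKappa u v ≤ S.invKappa U v :=
  D.invKappa_mono hm hm.2.2 le_rfl fun _ hy => D.lam_pos (mem_of_le_u hm hy.1.le hy.2.le) hy.2

/-- The redshift inequality integrated from `v₁` to `v`: up to the exponentially damped initial
value, `(ζ / nu)²` is bounded by the energy, measured from its value at the start on the horizon. -/
lemma ingoing_sq_le_exp (D : Collapse γ U R e ε S E) {a C v₁ : ℝ} (h1 : 1 ≤ v₁) (ha : 0 ≤ a)
    (hC : 0 ≤ C) (hm : (u, v) ∈ region γ U) (hv : v₁ ≤ v)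
    (hZ : ∀ x ∈ Ioo v₁ v, 2 * S.ingoing u x * (-(S.θ u x / S.r u x) -
        2 * S.redshift e u x / S.invKappa u x * S.ingoing u x) ≤ -(a * S.ingoing u x ^ 2) +
        C * -(2 / S.Ω u x ^ 2 * S.nu u x * S.θ u x ^ 2)) :
    S.ingoing u v ^ 2 ≤ Real.exp (-(a * (v - v₁))) * S.ingoing u v₁ ^ 2 +
      C * (E u v - E U v₁) := by
  have hsub : Icc v₁ v ⊆ Icc 1 v := Icc_subset_Icc_left h1
  have h2 := le_of_hasDerivAt_nonpos (f := fun x => Real.exp (x * a) *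
      (S.ingoing u x ^ 2 - C * (E u x - E U v₁))) hv
    ((Real.continuous_exp.comp_continuousOn (continuousOn_id.mul continuousOn_const)).mul
      ((((D.contOn_ingoing.slice_v D.curve hm).mono hsub).pow 2).sub (continuousOn_const.mul
        (((D.energy.w_v.continuousOn D.curve hm).mono hsub).sub continuousOn_const))))
    (fun x hx => (((hasDerivAt_id x).mul_const a).exp).mul
      ((D.hasDerivAt_ingoing_sq hm ⟨h1.trans_lt hx.1, hx.2⟩).sub
      (((D.energy.w_v.hasDerivAt D.curve hm ⟨h1.trans_lt hx.1, hx.2⟩).sub_const _).const_mul C)))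
    (fun x hx => by
      have hmx := D.curve.mem_of_le_v hm (h1.trans hx.1.le) hx.2.le
      have h3 := hZ x hx
      have h4 := sub_nonneg.2 (D.horizon_energy_le hmx h1 hx.1.le)
      have h5 : 0 ≤ a * (C * (E u x - E U v₁)) := by positivity
      have h6 := Real.exp_pos (x * a)
      simp only [id, Pi.sub_apply]
      rw [mul_assoc, ← mul_add]
      exact mul_nonpos_of_nonneg_of_nonpos h6.le (by linarith))
  have hm1 := D.curve.mem_of_le_v hm h1 hv
  have h3 := sub_nonneg.2 (D.horizon_energy_le hm1 h1 le_rfl)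
  have h4 : Real.exp (v * a) * (S.ingoing u v ^ 2 - C * (E u v - E U v₁)) ≤
      Real.exp (v₁ * a) * S.ingoing u v₁ ^ 2 := by
    refine h2.trans ?_
    gcongr
    have : 0 ≤ C * (E u v₁ - E U v₁) := by positivity
    linarith
  have h5 : Real.exp (v₁ * a) = Real.exp (v * a) * Real.exp (-(a * (v - v₁))) := by
    rw [← Real.exp_add]; ring_nf
  rw [h5, mul_assoc] at h4
  have := le_of_mul_le_mul_left h4 (Real.exp_pos _)
  linarith

/-! ### Decay of the energy and of the ingoing derivative -/

/-- If, on an ingoing ray, `(ζ / nu)²` exceeds a constant by at most a multiple of the energy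
between the point and the horizon, then Grönwall's inequality with `r` as the variable bounds that
energy. -/
lemma energy_gronwall (D : Collapse γ U R e ε S E) {C Y H : ℝ} (hC : 0 < C) (hY : 0 ≤ Y)
    (hH : 0 < H) (hm : (u, v) ∈ region γ U)
    (hh : ∀ x ∈ Ioo u U, S.oneSubMu e x v ≤ H)
    (hZ : ∀ x ∈ Ioo u U, S.ingoing x v ^ 2 ≤ Y + C * (E x v - E U v)) :
    Y + C * (E u v - E U v) ≤ Y * Real.exp (C * H / 2 * R) := by
  have h1 := le_of_hasDerivAt_nonneg (f := fun x => Real.exp (-(C * H / 2 * S.r x v)) *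
      (Y + C * (E x v - E U v))) hm.2.2
    ((Real.continuous_exp.comp_continuousOn
      (continuousOn_const.mul (D.regular.r_u.continuousOn hm)).neg).mul
      (continuousOn_const.add (continuousOn_const.mul
        ((D.energy.w_u.continuousOn hm).sub continuousOn_const))))
    (fun x hx => (((D.regular.r_u.hasDerivAt hm hx).const_mul _).neg.exp).mul
      ((((D.energy.w_u.hasDerivAt hm hx).sub_const _).const_mul C).const_add Y))
    (fun x hx => by
      have hmx := mem_of_le_u hm hx.1.le hx.2.le
      have hn := D.nu_neg hmx
      have h3 := hh x hx
      have h4 := hZ x hx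
      have h5 := sub_nonneg.2 (D.horizon_energy_le hmx hmx.1 le_rfl)
      have e1 : -(2 / S.Ω x v ^ 2 * S.lam x v * S.ζ x v ^ 2) =
          S.oneSubMu e x v * S.ingoing x v ^ 2 / 2 * S.nu x v := by
        rw [D.oneSubMu_eq hmx, ingoing]
        have := hn.ne
        field_simp
        ring
      have e2 : S.oneSubMu e x v * S.ingoing x v ^ 2 ≤ H * (Y + C * (E x v - E U v)) := by
        gcongr
      have e3 : 0 ≤ C * (-S.nu x v) / 2 *
          (H * (Y + C * (E x v - E U v)) - S.oneSubMu e x v * S.ingoing x v ^ 2) :=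
        mul_nonneg (by have : 0 ≤ -S.nu x v := by linarith
                       positivity) (by linarith)
      have h6 := Real.exp_pos (-(C * H / 2 * S.r x v))
      rw [e1, mul_assoc, ← mul_add]
      refine mul_nonneg h6.le ?_
      linarith)
  have h2 : Real.exp (-(C * H / 2 * S.r U v)) ≤ 1 := by
    rw [Real.exp_le_one_iff, neg_nonpos]
    have := D.r_pos (D.curve.horizon_mem hm.1)
    positivity
  have h3 : Real.exp (-(C * H / 2 * S.r u v)) * (Y + C * (E u v - E U v)) ≤ Y := by
    refine h1.trans ?_
    simp only [sub_self, mul_zero, add_zero]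
    exact mul_le_of_le_one_left hY h2
  have h4 : Real.exp (-(C * H / 2 * R)) ≤ Real.exp (-(C * H / 2 * S.r u v)) := by
    gcongr
    exact D.r_le hm
  have h5 := sub_nonneg.2 (D.horizon_energy_le hm hm.1 le_rfl)
  have h6 : Real.exp (-(C * H / 2 * R)) * (Y + C * (E u v - E U v)) ≤ Y :=
    (mul_le_mul_of_nonneg_right h4 (by positivity)).trans h3
  rw [Real.exp_neg, inv_mul_le_iff₀ (Real.exp_pos _)] at h6
  linarith

/-- The main estimate: after a time `T`, both `(ζ / nu)²` and the energy of an ingoing ray are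
controlled by the exponentially damped initial size of `(ζ / nu)²` and the energy lost meanwhile,
which bounds the flux through the horizon. -/
lemma exists_decay_step (D : Collapse γ U R e ε S E) {v₀ : ℝ} (h0 : 1 ≤ v₀)
    (hM : |e| < S.renormMass e U v₀) :
    ∃ a C : ℝ, 0 < a ∧ 1 ≤ C ∧ ∀ v₁ T A, v₀ ≤ v₁ → 0 ≤ T →
      (∀ u, (u, v₁) ∈ region γ U → S.ingoing u v₁ ^ 2 ≤ A) →
      ∀ Y, Y = C * (Real.exp (-(a * T)) * A + ((E (γ v₁) v₁ - E U v₁) -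
        (E (γ (v₁ + T)) (v₁ + T) - E U (v₁ + T)))) →
      (∀ u, (u, v₁ + T) ∈ region γ U → S.ingoing u (v₁ + T) ^ 2 ≤ Y) ∧
        E (γ (v₁ + T)) (v₁ + T) - E U (v₁ + T) ≤ Y := by
  obtain ⟨b, hb, hbB⟩ := D.exists_le_redshift h0 hM
  obtain ⟨c, hc, hr⟩ := D.exists_lt_r
  obtain ⟨A₀, hA₀, hZ₀⟩ := D.exists_ingoing_sq_le h0 hM
  obtain ⟨K, hK, hk⟩ := D.exists_invKappa_le hA₀ hZ₀
  obtain ⟨H, hH, hh⟩ := D.exists_oneSubMu_le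
  set C₁ : ℝ := 1 / (b * c ^ 2) with hC₁
  have hC₁0 : 0 < C₁ := by positivity
  set X := Real.exp (C₁ * H / 2 * R)
  have hX : 1 ≤ X := Real.one_le_exp (by have := D.R_pos; positivity)
  have hCC : 0 ≤ (1 + C₁) * X / C₁ := by positivity
  have hCX : 1 ≤ (1 + C₁) * X := by nlinarith
  refine ⟨2 * b / K, (1 + C₁) * X + (1 + C₁) * X / C₁, by positivity, by linarith, ?_⟩
  intro v₁ T A hv hT hA Y hY
  have hv1 := h0.trans hv
  have hw : v₁ ≤ v₁ + T := by linarith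
  have hw1 := hv1.trans hw
  set w := v₁ + T with hwdef
  have hmc := D.curve.curve_mem hw1
  have hA0 : 0 ≤ A := (sq_nonneg _).trans (hA _ (D.curve.curve_mem hv1))
  have hflux : 0 ≤ E U w - E U v₁ := sub_nonneg.2 (D.energy_le_v (D.curve.horizon_mem hw1) hv1 hw)
  have hloss : E U w - E U v₁ ≤ (E (γ v₁) v₁ - E U v₁) - (E (γ w) w - E U w) := by
    have := D.energy_antitone (a := v₁) (b := w) hv1 hw1 hw
    simp only at this
    linarith
  set W := Real.exp (-(2 * b / K * T)) * A + ((E (γ v₁) v₁ - E U v₁) - (E (γ w) w - E U w)) with hW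
  have hδ : 0 ≤ Real.exp (-(2 * b / K * T)) * A := by positivity
  have hW0 : 0 ≤ W := by linarith
  set Y₀ := Real.exp (-(2 * b / K * T)) * A + C₁ * (E U w - E U v₁) with hY₀
  have hY₀0 : 0 ≤ Y₀ := by positivity
  have hY₀W : Y₀ ≤ (1 + C₁) * W := by
    have : C₁ * (E U w - E U v₁) ≤ C₁ * W := by gcongr; linarith
    linarith
  have key : ∀ u, (u, w) ∈ region γ U → S.ingoing u w ^ 2 ≤ Y₀ + C₁ * (E u w - E U w) := by
    intro u hm
    have h2 := D.ingoing_sq_le_exp (a := 2 * b / K) (C := C₁) hv1 (by positivity) hC₁0.le hm hw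
      (fun x hx => by
        have hx1 := hv.trans hx.1.le
        have hmx := D.curve.mem_of_le_v hm (h0.trans hx1) hx.2.le
        have h3 := D.ingoing_sq_deriv_le hmx hb hc (hbB _ _ hmx hx1) (hr _ _ hmx).le
        refine h3.trans ?_
        gcongr
        · linarith [hb.trans_le (hbB _ _ hmx hx1)]
        · exact D.invKappa_pos hmx
        · exact hbB _ _ hmx hx1
        · exact (D.invKappa_le_horizon hmx).trans (hk x hmx.1 hx1))
    have h3 : Real.exp (-(2 * b / K * (w - v₁))) * S.ingoing u v₁ ^ 2 ≤
        Real.exp (-(2 * b / K * T)) * A := by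
      rw [hwdef, add_sub_cancel_left]
      gcongr
      exact hA u (D.curve.mem_of_le_v hm hv1 hw)
    have h4 : C₁ * (E u w - E U v₁) = C₁ * (E U w - E U v₁) + C₁ * (E u w - E U w) := by ring
    linarith
  have hE : ∀ u, (u, w) ∈ region γ U → Y₀ + C₁ * (E u w - E U w) ≤ (1 + C₁) * X * W := by
    intro u hm
    have h2 := D.energy_gronwall hC₁0 hY₀0 hH hm
      (fun x hx => hh x w (mem_of_le_u hm hx.1.le hx.2.le))
      (fun x hx => key x (mem_of_le_u hm hx.1.le hx.2.le))
    refine h2.trans ?_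
    rw [mul_right_comm]
    gcongr
  have hsplit : Y = (1 + C₁) * X * W + (1 + C₁) * X / C₁ * W := by rw [hY]; ring
  have hp1 : 0 ≤ (1 + C₁) * X * W := by positivity
  have hp2 : 0 ≤ (1 + C₁) * X / C₁ * W := by positivity
  refine ⟨fun u hm => ?_, ?_⟩
  · linarith [key u hm, hE u hm]
  · have h2 := hE _ hmc
    have h3 : E (γ w) w - E U w ≤ (1 + C₁) * X * W / C₁ := by
      rw [le_div_iff₀ hC₁0]
      linarith
    have h4 : (1 + C₁) * X * W / C₁ = (1 + C₁) * X / C₁ * W := by ring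
    linarith

/-- Exponential decay of `(ζ / nu)²` along a sequence of equidistant ingoing rays. -/
lemma exists_geometric_decay (D : Collapse γ U R e ε S E) {v₀ : ℝ} (h0 : 1 ≤ v₀)
    (hM : |e| < S.renormMass e U v₀) :
    ∃ T q P : ℝ, 0 < T ∧ 0 < q ∧ q < 1 ∧ 0 ≤ P ∧ ∀ (n : ℕ) (w : ℝ), v₀ ≤ w →
      ∀ u, (u, w + n * T) ∈ region γ U → S.ingoing u (w + n * T) ^ 2 ≤ P * q ^ n := by
  obtain ⟨a, C, ha, hC, hstep⟩ := D.exists_decay_step h0 hM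
  obtain ⟨A₀, hA₀, hZ₀⟩ := D.exists_ingoing_sq_le h0 hM
  set F : ℝ → ℝ := fun v => E (γ v) v - E U v with hF
  have hF0 : ∀ v, 1 ≤ v → 0 ≤ F v := fun v hv =>
    sub_nonneg.2 (D.horizon_energy_le (D.curve.curve_mem hv) hv le_rfl)
  have hFle : ∀ v, v₀ ≤ v → F v ≤ F v₀ := by
    intro v hv
    have h1 := D.energy_antitone (a := v₀) (b := v) h0 (h0.trans hv) hv
    have h2 := D.energy_le_v (D.curve.horizon_mem (h0.trans hv)) h0 hv
    simp only [hF] at h1 ⊢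
    linarith
  -- `T` is so large that the damping factor absorbs the constant of the main estimate.
  set T := Real.log (4 * C) / a with hTdef
  have hT : 0 < T := div_pos (Real.log_pos (by linarith)) ha
  have hexp : C * Real.exp (-(a * T)) = 1 / 4 := by
    rw [hTdef, mul_div_cancel₀ _ ha.ne', Real.exp_neg, Real.exp_log (by linarith)]
    field_simp
  -- Half of the new bound for `(ζ / nu)²` also bounds the energy, which makes the factor of the
  -- energy on the left exceed the one on the right.
  set q := C / (C + 1 / 2) with hq
  have hq0 : 0 < q := by positivity
  have hq1 : q < 1 := by rw [hq, div_lt_one (by positivity)]; linarith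
  have hq2 : 1 / 2 ≤ q := by rw [hq, div_le_div_iff₀ (by norm_num) (by positivity)]; linarith
  have hqC : q * (C + 1 / 2) = C := by rw [hq]; field_simp
  set A₁ := A₀ + F v₀ with hA₁
  have hFv₀ := hF0 v₀ h0
  have hA₁0 : 0 ≤ A₁ := by positivity
  set P₀ := A₁ / 2 + (C + 1 / 2) * F v₀ with hP₀
  have hP₀0 : 0 ≤ P₀ := by positivity
  refine ⟨T, q, 2 * P₀, hT, hq0, hq1, by positivity, fun n w hw => ?_⟩
  have hind : ∃ A, (∀ u, (u, w + n * T) ∈ region γ U → S.ingoing u (w + n * T) ^ 2 ≤ A) ∧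
      F (w + n * T) ≤ A ∧ A / 2 + (C + 1 / 2) * F (w + n * T) ≤ P₀ * q ^ n := by
    induction n with
    | zero =>
      refine ⟨A₁, fun u hm => ?_, ?_, ?_⟩
      · have := hZ₀ u _ hm (by simpa using hw)
        linarith
      · have := hFle w hw
        simp only [Nat.cast_zero, zero_mul, add_zero]
        linarith
      · have := hFle w hw
        simp only [Nat.cast_zero, zero_mul, add_zero, pow_zero, mul_one]
        rw [hP₀]
        gcongr
    | succ n ih =>
      obtain ⟨A, h1, h2, h3⟩ := ih
      have hv : v₀ ≤ w + n * T := by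
        have : 0 ≤ n * T := by positivity
        linarith
      have hcast : w + (n + 1 : ℕ) * T = w + n * T + T := by push_cast; ring
      rw [hcast]
      obtain ⟨h4, h5⟩ := hstep (w + n * T) T A hv hT.le h1 _ rfl
      refine ⟨_, h4, h5, ?_⟩
      have h6 := hF0 (w + n * T) (h0.trans hv)
      have hA0 : 0 ≤ A := h6.trans h2
      have h7 : q * (A / 2 + (C + 1 / 2) * F (w + n * T)) ≤ q * (P₀ * q ^ n) := by gcongr
      have h8 : q * (A / 2 + (C + 1 / 2) * F (w + n * T)) =
          q * A / 2 + C * F (w + n * T) := by linear_combination F (w + n * T) * hqC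
      have h9 : 1 / 2 * A ≤ q * A := by gcongr
      have h10 : C * (Real.exp (-(a * T)) * A + (F (w + n * T) - F (w + n * T + T))) =
          A / 4 + C * F (w + n * T) - C * F (w + n * T + T) := by
        linear_combination A * hexp
      change F (w + n * T + T) ≤
        C * (Real.exp (-(a * T)) * A + (F (w + n * T) - F (w + n * T + T))) at h5
      change C * (Real.exp (-(a * T)) * A + (F (w + n * T) - F (w + n * T + T))) / 2 + _ ≤ _
      rw [h10] at h5 ⊢
      have h11 : P₀ * q ^ (n + 1) = q * (P₀ * q ^ n) := by ring
      rw [h11]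
      linarith
  obtain ⟨A, h1, h2, h3⟩ := hind
  intro u hm
  have h4 := h1 u hm
  have hw1 : 1 ≤ w + n * T := hm.1
  have h5 := hF0 _ hw1
  have h6 : 0 ≤ (C + 1 / 2) * F (w + n * T) := by positivity
  linarith

/-! ### The outgoing derivative -/

/-- On the timelike curve, `θ² ≤ (ζ / nu)²`: this is the nonpositivity of the derivative of the
energy along the curve, in which `γ' = -1 / nu` since `r` is constant. -/
lemma θ_sq_curve_le (D : Collapse γ U R e ε S E) (hv : 1 ≤ v) :
    S.θ (γ v) v ^ 2 ≤ S.ingoing (γ v) v ^ 2 := by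
  obtain ⟨s, hs, hγ⟩ := D.curve.timelike v hv
  have hm := D.curve.curve_mem hv
  have d1 := hasDerivWithinAt_curve D.curve D.regular.r_u D.regular.r_v D.regular.lam_cont hv hγ
  have hIci : Ici v ⊆ Ici 1 := Ici_subset_Ici.2 hv
  have d2 : HasDerivWithinAt (fun w => S.r (γ w) w) 0 (Ici v) v :=
    (hasDerivWithinAt_const v (Ici v) R).congr (fun w hw => D.bdry.r_bdry w (hIci hw))
      (D.bdry.r_bdry v hv)
  have e1 := (uniqueDiffWithinAt_Ici v).eq_deriv _ d1 d2
  rw [D.bdry.lam_bdry v hv] at e1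
  have hflux : ContOn (region γ U) (fun u v => -(2 / S.Ω u v ^ 2 * S.nu u v * S.θ u v ^ 2)) := by
    refine (((continuousOn_const.div (D.regular.Ω_cont.pow 2) fun p hp => ?_).mul
      D.regular.nu_cont).mul (D.regular.θ_cont.pow 2)).neg
    exact (pow_pos (D.Ω_pos (u := p.1) (v := p.2) hp) 2).ne'
  have d3 := hasDerivWithinAt_curve D.curve D.energy.w_u D.energy.w_v hflux hv hγ
  have e2 : -(2 / S.Ω (γ v) v ^ 2 * S.lam (γ v) v * S.ζ (γ v) v ^ 2) * s +
      -(2 / S.Ω (γ v) v ^ 2 * S.nu (γ v) v * S.θ (γ v) v ^ 2) ≤ 0 := by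
    rw [← d3.derivWithin (uniqueDiffWithinAt_Ici v)]
    exact (D.energy_antitone.mono hIci).derivWithin_nonpos
  rw [D.bdry.lam_bdry v hv] at e2
  have hΩ := D.Ω_pos hm
  have hn := D.nu_neg hm
  have e3 : s = -1 / S.nu (γ v) v := by
    have := hn.ne
    field_simp
    linarith
  have e4 : -(2 / S.Ω (γ v) v ^ 2 * 1 * S.ζ (γ v) v ^ 2) * s +
      -(2 / S.Ω (γ v) v ^ 2 * S.nu (γ v) v * S.θ (γ v) v ^ 2) =
      2 / S.Ω (γ v) v ^ 2 * -S.nu (γ v) v * (S.θ (γ v) v ^ 2 - S.ingoing (γ v) v ^ 2) := by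
    rw [e3, ingoing]
    have := hn.ne
    field_simp
    ring
  rw [e4] at e2
  by_contra! h
  have : 0 < 2 / S.Ω (γ v) v ^ 2 * -S.nu (γ v) v *
      (S.θ (γ v) v ^ 2 - S.ingoing (γ v) v ^ 2) := by
    have h1 : 0 < -S.nu (γ v) v := by linarith
    have h2 := sub_pos.2 h
    positivity
  linarith

/-- On each ingoing ray, `θ` is controlled by `ζ / nu`: at the timelike curve by the boundary
condition, and towards the horizon by the wave equation. -/
lemma exists_θ_le (D : Collapse γ U R e ε S E) :
    ∃ C, 0 ≤ C ∧ ∀ v N, 1 ≤ v → 0 ≤ N → (∀ u, (u, v) ∈ region γ U → |S.ingoing u v| ≤ N) →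
      ∀ u, (u, v) ∈ region γ U → |S.θ u v| ≤ C * N := by
  obtain ⟨c, hc, hr⟩ := D.exists_lt_r
  obtain ⟨L, hL, hl⟩ := D.exists_lam_le
  have hR := D.R_pos
  refine ⟨1 + L / c * R, by positivity, fun v N hv hN hZ u hm => ?_⟩
  have hmc := D.curve.curve_mem hv
  have hb : |S.θ (γ v) v| ≤ N := (sq_le_sq.1 (D.θ_sq_curve_le hv)).trans (hZ _ hmc)
  have hru := D.r_pos hm
  have hsub : Icc (γ v) u ⊆ Icc (γ v) U := Icc_subset_Icc_right hm.2.2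
  have hbound : ∀ x ∈ Ioo (γ v) u,
      |S.ζ x v * S.lam x v / S.r x v| ≤ L / c * N * -S.nu x v := by
    intro x hx
    have hmx := mem_of_le_u hmc hx.1.le (hx.2.le.trans hm.2.2)
    have hn := D.nu_neg hmx
    have h1 : S.ζ x v * S.lam x v / S.r x v =
        S.ingoing x v * (S.lam x v / S.r x v) * S.nu x v := by
      rw [ingoing]
      have := hn.ne
      field_simp
    have h2 : S.lam x v / S.r x v ≤ L / c := by
      gcongr
      · exact hl x v hmx
      · exact (hr x v hmx).le
    have h3 : 0 ≤ S.lam x v / S.r x v := div_nonneg (D.lam_nonneg hmx) (D.r_pos hmx).le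
    rw [h1, abs_mul, abs_mul, abs_of_neg hn, abs_of_nonneg h3, mul_comm (L / c)]
    have h4 : 0 ≤ -S.nu x v := by linarith
    gcongr
    exact hZ x hmx
  have hd : ∀ x ∈ Ioo (γ v) u, x ∈ Ioo (γ v) U := fun x hx => ⟨hx.1, hx.2.trans_le hm.2.2⟩
  have h1 := le_of_hasDerivAt_nonpos (f := fun x => S.θ x v + L / c * N * S.r x v) hm.2.1
    (((D.wave.θ_u.continuousOn hmc).add
      (continuousOn_const.mul (D.regular.r_u.continuousOn hmc))).mono hsub)
    (fun x hx => (D.wave.θ_u.hasDerivAt hmc (hd x hx)).add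
      ((D.regular.r_u.hasDerivAt hmc (hd x hx)).const_mul _))
    (fun x hx => by linarith [hbound x hx, neg_abs_le (S.ζ x v * S.lam x v / S.r x v)])
  have h2 := le_of_hasDerivAt_nonneg (f := fun x => S.θ x v - L / c * N * S.r x v) hm.2.1
    (((D.wave.θ_u.continuousOn hmc).sub
      (continuousOn_const.mul (D.regular.r_u.continuousOn hmc))).mono hsub)
    (fun x hx => (D.wave.θ_u.hasDerivAt hmc (hd x hx)).sub
      ((D.regular.r_u.hasDerivAt hmc (hd x hx)).const_mul _))
    (fun x hx => by linarith [hbound x hx, le_abs_self (S.ζ x v * S.lam x v / S.r x v)])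
  simp only [D.bdry.r_bdry v hv] at h1 h2
  have h3 : 0 ≤ L / c * N * S.r u v := by positivity
  obtain ⟨h4, h5⟩ := abs_le.1 hb
  rw [abs_le]
  constructor <;> linarith

end Collapse

/-! ### From geometric to polynomial decay -/

/-- A quantity with geometric decay along equidistant sequences decays faster than any power. -/
lemma exists_le_rpow_of_geometric {T q : ℝ} (hT : 0 < T) (hq0 : 0 < q) (hq1 : q < 1)
    {v₀ : ℝ} (h0 : 1 ≤ v₀) (p : ℝ) :
    ∃ C, 0 ≤ C ∧ ∀ v, v₀ ≤ v → ∃ (n : ℕ) (w : ℝ), v₀ ≤ w ∧ v = w + n * T ∧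
      q ^ n ≤ C * v ^ (-p) := by
  obtain ⟨k, hk⟩ := exists_nat_ge p
  have ht := tendsto_pow_const_mul_const_pow_of_abs_lt_one k
    (show |q| < 1 by rw [abs_of_pos hq0]; exact hq1)
  obtain ⟨C, hC⟩ := ht.comp (tendsto_add_atTop_nat 1) |>.bddAbove_range
  have hC' : ∀ n : ℕ, ((n : ℝ) + 1) ^ k * q ^ (n + 1) ≤ C := fun n => by
    have := hC ⟨n, rfl⟩
    simpa using this
  have hC0 : 0 ≤ C := le_trans (by positivity) (hC' 0)
  refine ⟨(v₀ + T) ^ k * C / q, by positivity, fun v hv => ?_⟩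
  have hv0 : 0 < v := by linarith
  have hfl := Nat.floor_le (a := (v - v₀) / T) (div_nonneg (by linarith) hT.le)
  have hfl' := Nat.lt_floor_add_one ((v - v₀) / T)
  set n := ⌊(v - v₀) / T⌋₊
  rw [le_div_iff₀ hT] at hfl
  rw [div_lt_iff₀ hT] at hfl'
  refine ⟨n, v - n * T, by linarith, by ring, ?_⟩
  have h1 : v ≤ (v₀ + T) * (n + 1) := by nlinarith [Nat.cast_nonneg (α := ℝ) n]
  have h2 : v ^ p ≤ ((v₀ + T) * (n + 1)) ^ k := by
    calc v ^ p ≤ v ^ (k : ℝ) := Real.rpow_le_rpow_of_exponent_le (by linarith) hk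
      _ = v ^ k := Real.rpow_natCast v k
      _ ≤ _ := by gcongr
  rw [Real.rpow_neg hv0.le, ← div_eq_mul_inv, le_div_iff₀ (by positivity), le_div_iff₀ hq0]
  calc q ^ n * v ^ p * q ≤ q ^ n * ((v₀ + T) * (n + 1)) ^ k * q := by gcongr
    _ = (v₀ + T) ^ k * (((n : ℝ) + 1) ^ k * q ^ (n + 1)) := by rw [mul_pow]; ring
    _ ≤ _ := by gcongr; exact hC' n

namespace Collapse

variable {γ : ℝ → ℝ} {U R e ε : ℝ} {S : Fields} {E : ℝ → ℝ → ℝ} {u v : ℝ}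

/-- Once the renormalized mass of the horizon exceeds `|e|`, `θ` decays faster than any power. -/
lemma exists_θ_decay (D : Collapse γ U R e ε S E) {v₀ : ℝ} (h0 : 1 ≤ v₀)
    (hM : |e| < S.renormMass e U v₀) {p : ℝ} (hp : 0 < p) :
    ∃ C : ℝ, ∀ u v : ℝ, (u, v) ∈ region γ U → |S.θ u v| ≤ C * v ^ (-p) := by
  obtain ⟨T, q, P, hT, hq0, hq1, hP, hdec⟩ := D.exists_geometric_decay h0 hM
  obtain ⟨C₁, hC₁, hθ⟩ := D.exists_θ_le
  obtain ⟨C₂, hC₂, hpow⟩ := exists_le_rpow_of_geometric hT hq0 hq1 h0 (2 * p)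
  obtain ⟨C₃, hC₃⟩ := D.exists_abs_le_of_le D.regular.θ_cont v₀
  refine ⟨C₁ * √(P * C₂) + |C₃| * v₀ ^ p, fun u v hm => ?_⟩
  have hv0 : 0 < v := by linarith [hm.1]
  have hpos : 0 ≤ v ^ (-p) := by positivity
  rw [add_mul]
  rcases le_total v v₀ with hv | hv
  · have h1 : 1 ≤ v₀ ^ p * v ^ (-p) := by
      rw [Real.rpow_neg hv0.le, ← div_eq_mul_inv, one_le_div (by positivity)]
      gcongr
    have h2 : |S.θ u v| ≤ |C₃| := (hC₃ u v hm hv).trans (le_abs_self _)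
    have h3 : |C₃| * 1 ≤ |C₃| * (v₀ ^ p * v ^ (-p)) := by gcongr
    have h4 : 0 ≤ C₁ * √(P * C₂) * v ^ (-p) := by positivity
    linarith
  · obtain ⟨n, w, hw, rfl, hn⟩ := hpow v hv
    have h1 := hθ (w + n * T) (√(P * C₂) * (w + n * T) ^ (-p)) hm.1 (by positivity) (by
      intro x hx
      refine abs_le_of_sq_le_sq ?_ (by positivity)
      have h2 := hdec n w hw x hx
      have h3 : P * q ^ n ≤ P * (C₂ * (w + n * T) ^ (-(2 * p))) := by gcongr
      have h4 : -(2 * p) = -p * (2 : ℕ) := by push_cast; ring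
      rw [h4, Real.rpow_mul hv0.le, Real.rpow_natCast] at h3
      rw [mul_pow, Real.sq_sqrt (by positivity)]
      linarith) u hm
    have h2 : 0 ≤ |C₃| * v₀ ^ p * (w + n * T) ^ (-p) := by positivity
    linarith

end Collapse

/-! ### Positivity of the mass of an uncharged horizon -/

namespace Collapse

variable {γ : ℝ → ℝ} {U R ε : ℝ} {S : Fields} {E : ℝ → ℝ → ℝ} {u v : ℝ}

lemma contOn_renormMass {e : ℝ} (D : Collapse γ U R e ε S E) :
    ContOn (region γ U) (S.renormMass e) := by
  have hΩ : ∀ p ∈ region γ U, S.Ω p.1 p.2 ^ 2 ≠ 0 := fun p hp =>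
    (pow_pos (D.Ω_pos (u := p.1) (v := p.2) hp) 2).ne'
  have hr : ∀ p ∈ region γ U, 2 * S.r p.1 p.2 ≠ 0 := fun p hp =>
    (mul_pos two_pos (D.r_pos (u := p.1) (v := p.2) hp)).ne'
  exact ((D.regular.r_cont.div_const 2).mul (continuousOn_const.add
    (((continuousOn_const.div (D.regular.Ω_cont.pow 2) hΩ).mul D.regular.nu_cont).mul
      D.regular.lam_cont))).add
    (continuousOn_const.div (continuousOn_const.mul D.regular.r_cont) hr)

lemma half_le_oneSubMu (D : Collapse γ U R 0 ε S E) {c : ℝ}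
    (hm : (u, v) ∈ region γ U) (hr : c ≤ S.r u v) (hM : S.renormMass 0 u v ≤ c / 4) :
    1 / 2 ≤ S.oneSubMu 0 u v := by
  have h1 := D.r_pos hm
  have h2 : 2 * S.renormMass 0 u v / S.r u v ≤ 1 / 2 := by
    rw [div_le_iff₀ h1]
    linarith
  rw [oneSubMu]
  norm_num
  linarith

/-- Along an outgoing ray with small mass, `(ζ / nu)²` remains bounded without any use of the
redshift: there `κ ≤ 2 lam`, so the total `v`-integral of `κ` is bounded by the radius. -/
lemma ingoing_sq_le_of_mass_le (D : Collapse γ U R 0 ε S E) {c B : ℝ} (hc : 0 < c)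
    (hr : ∀ u v, (u, v) ∈ region γ U → c < S.r u v)
    (hB : ∀ u v, (u, v) ∈ region γ U → v ≤ 1 → |S.ingoing u v| ≤ B)
    (hm : (u, v) ∈ region γ U) (hM : ∀ x ∈ Ioo 1 v, S.renormMass 0 u x ≤ c / 4) :
    S.ingoing u v ^ 2 ≤ Real.exp (2 * R) * (B ^ 2 + 2 / c ^ 2 * (E (γ 1) 1 - E U 1)) := by
  have h1 := le_of_hasDerivAt_nonpos (f := fun x => Real.exp (-(2 * S.r u x)) *
      S.ingoing u x ^ 2 - 2 / c ^ 2 * E u x) hm.1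
    (((Real.continuous_exp.comp_continuousOn (continuousOn_const.mul
      (D.regular.r_v.continuousOn D.curve hm)).neg).mul
      ((D.contOn_ingoing.slice_v D.curve hm).pow 2)).sub
      (continuousOn_const.mul (D.energy.w_v.continuousOn D.curve hm)))
    (fun x hx => ((((D.regular.r_v.hasDerivAt D.curve hm hx).const_mul 2).neg.exp).mul
      (D.hasDerivAt_ingoing_sq hm hx)).sub
      ((D.energy.w_v.hasDerivAt D.curve hm hx).const_mul _))
    (fun x hx => by
      have hmx := D.curve.mem_of_le_v hm hx.1.le hx.2.le
      have hcr := (hr _ _ hmx).le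
      have hrx := D.r_pos hmx
      have hk := D.invKappa_pos hmx
      have hl := D.lam_nonneg hmx
      have hh := D.half_le_oneSubMu hmx hcr (hM x hx)
      rw [D.oneSubMu_eq_mul hmx] at hh
      have hred : 0 ≤ S.redshift 0 u x := by
        rw [D.redshift_eq hmx]
        have := D.mass_nonneg hmx
        norm_num
        positivity
      have hexp : Real.exp (-(2 * S.r u x)) ≤ 1 := by
        rw [Real.exp_le_one_iff]; linarith
      have hexp0 := Real.exp_pos (-(2 * S.r u x))
      rw [energy_v_eq]
      simp only [Pi.neg_apply]
      generalize S.redshift 0 u x = b at *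
      generalize S.invKappa u x = k at *
      generalize S.r u x = r at *
      generalize S.θ u x = θ at *
      generalize S.ingoing u x = Z at *
      generalize S.lam u x = l at *
      have e1 : 0 ≤ (Z + k * θ / r) ^ 2 / k := by positivity
      have e2 : (Z + k * θ / r) ^ 2 / k = Z ^ 2 / k + 2 * Z * (θ / r) + k * θ ^ 2 / r ^ 2 := by
        field_simp
        ring
      have e3 : k * θ ^ 2 / r ^ 2 ≤ k * θ ^ 2 / c ^ 2 := by gcongr
      have e4 : Z ^ 2 / k ≤ 2 * l * Z ^ 2 := by
        rw [div_le_iff₀ hk]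
        nlinarith [sq_nonneg Z]
      have e5 : 0 ≤ 4 * b / k * Z ^ 2 := by positivity
      have e6 : 2 * Z * (-(θ / r) - 2 * b / k * Z) = -(2 * Z * (θ / r)) - 4 * b / k * Z ^ 2 := by
        ring
      have e7 : 2 / c ^ 2 * (k * θ ^ 2 / 2) = k * θ ^ 2 / c ^ 2 := by field_simp
      have e8 : 0 ≤ k * θ ^ 2 / c ^ 2 := by positivity
      rw [e6, e7]
      have e9 : Real.exp (-(2 * r)) * -(2 * l) * Z ^ 2 + Real.exp (-(2 * r)) *
          (-(2 * Z * (θ / r)) - 4 * b / k * Z ^ 2) ≤ Real.exp (-(2 * r)) * (k * θ ^ 2 / c ^ 2) := by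
        rw [mul_assoc, ← mul_add]
        gcongr
        linarith
      have e10 : Real.exp (-(2 * r)) * (k * θ ^ 2 / c ^ 2) ≤ k * θ ^ 2 / c ^ 2 :=
        mul_le_of_le_one_left e8 hexp
      linarith)
  have hm1 := D.curve.mem_of_le_v hm le_rfl hm.1
  have h2 := D.horizon_energy_le hm1 le_rfl le_rfl
  have h3 := D.energy_le_curve hm le_rfl hm.1
  have h4 : S.ingoing u 1 ^ 2 ≤ B ^ 2 := by
    rw [← sq_abs (S.ingoing u 1)]
    gcongr
    exact hB u 1 hm1 le_rfl
  have h5 : 2 / c ^ 2 * (E u v - E u 1) ≤ 2 / c ^ 2 * (E (γ 1) 1 - E U 1) := by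
    gcongr
  have h6 : Real.exp (-(2 * S.r u 1)) * S.ingoing u 1 ^ 2 ≤ S.ingoing u 1 ^ 2 :=
    mul_le_of_le_one_left (sq_nonneg _)
      (by rw [Real.exp_le_one_iff]; linarith [D.r_pos hm1])
  have h7 : Real.exp (-(2 * R)) ≤ Real.exp (-(2 * S.r u v)) := by
    gcongr
    exact D.r_le hm
  have h8 := mul_le_mul_of_nonneg_right h7 (sq_nonneg (S.ingoing u v))
  rw [Real.exp_neg] at h8
  rw [← inv_mul_le_iff₀ (Real.exp_pos _)]
  linarith

/-- Along an outgoing ray with small mass, `nu` remains bounded, again because `κ ≤ 2 lam`. -/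
lemma neg_nu_le_of_mass_le (D : Collapse γ U R 0 ε S E) {c : ℝ} (hc : 0 < c)
    (hr : ∀ u v, (u, v) ∈ region γ U → c < S.r u v)
    (hm : (u, v) ∈ region γ U) (hM : ∀ x ∈ Ioo 1 v, S.renormMass 0 u x ≤ c / 4) :
    -S.nu u v ≤ Real.exp (R / c) := by
  have h1 := le_of_hasDerivAt_nonneg (f := fun x => S.nu u x * Real.exp (-(S.r u x / c))) hm.1
    ((D.radius.nu_v.continuousOn D.curve hm).mul (Real.continuous_exp.comp_continuousOn
      ((D.regular.r_v.continuousOn D.curve hm).div_const c).neg))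
    (fun x hx => (D.radius.nu_v.hasDerivAt D.curve hm hx).mul
      (((D.regular.r_v.hasDerivAt D.curve hm hx).div_const c).neg.exp))
    (fun x hx => by
      have hmx := D.curve.mem_of_le_v hm hx.1.le hx.2.le
      have hcr := (hr _ _ hmx).le
      have hk := D.invKappa_pos hmx
      have hn := D.nu_neg hmx
      have hl := D.lam_nonneg hmx
      have hh := D.half_le_oneSubMu hmx hcr (hM x hx)
      rw [D.oneSubMu_eq_mul hmx] at hh
      have hred : S.renormMass 0 u x / S.r u x ^ 2 ≤ 1 / (4 * c) := by
        calc S.renormMass 0 u x / S.r u x ^ 2 ≤ (c / 4) / c ^ 2 := by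
              gcongr
              exact hM x hx
          _ = _ := by field_simp
      rw [D.half_Ω_sq hmx]
      have e1 : 2 * (S.renormMass 0 u x / S.r u x ^ 2) / S.invKappa u x ≤ S.lam u x / c := by
        rw [div_le_div_iff₀ hk hc]
        have : 2 * (S.renormMass 0 u x / S.r u x ^ 2) * c ≤ 2 * (1 / (4 * c)) * c := by gcongr
        have e : 2 * (1 / (4 * c)) * c = 1 / 2 := by field_simp; norm_num
        linarith
      have e2 : - -(2 * S.nu u x / S.invKappa u x) *
            (S.renormMass 0 u x / S.r u x ^ 2 - 0 ^ 2 / S.r u x ^ 3) *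
            Real.exp (-(S.r u x / c)) +
          S.nu u x * (Real.exp (-(S.r u x / c)) * -(S.lam u x / c)) =
          -S.nu u x * Real.exp (-(S.r u x / c)) * (S.lam u x / c -
            2 * (S.renormMass 0 u x / S.r u x ^ 2) / S.invKappa u x) := by
        ring
      simp only [Pi.neg_apply]
      rw [e2]
      have e3 : 0 ≤ -S.nu u x := by linarith
      have e4 := sub_nonneg.2 e1
      positivity)
  have hm1 := D.curve.mem_of_le_v hm le_rfl hm.1
  simp only [D.bdry.nu_init u ((D.curve.one_le hm.1).trans hm.2.1) hm.2.2] at h1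
  have h2 : Real.exp (-(S.r u 1 / c)) ≤ 1 := by
    rw [Real.exp_le_one_iff, neg_nonpos]
    have := D.r_pos hm1
    positivity
  have h3 : Real.exp (-(R / c)) ≤ Real.exp (-(S.r u v / c)) := by
    gcongr
    exact D.r_le hm
  have h4 := mul_le_mul_of_nonneg_left h3 (show 0 ≤ -S.nu u v by linarith [D.nu_neg hm])
  rw [Real.exp_neg, mul_inv_le_iff₀ (Real.exp_pos _)] at h4
  have h5 : -S.nu u v * Real.exp (-(S.r u v / c)) ≤ 1 := by linarith
  calc -S.nu u v ≤ -S.nu u v * Real.exp (-(S.r u v / c)) * Real.exp (R / c) := h4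
    _ ≤ 1 * Real.exp (R / c) := by gcongr
    _ = _ := one_mul _

/-- If the horizon has no mass, bounds for `ζ / nu` and `nu` near it make the mass small. -/
lemma mass_le_of_horizon_mass (D : Collapse γ U R 0 ε S E) {A G : ℝ} (hm : (u, v) ∈ region γ U)
    (h0 : S.renormMass 0 U v ≤ 0) (hA : ∀ x ∈ Ioo u U, S.ingoing x v ^ 2 ≤ A)
    (hG : ∀ x ∈ Ioo u U, -S.nu x v ≤ G) :
    S.renormMass 0 u v ≤ ε * (A * G / 2) * (U - u) := by
  have h1 := le_of_hasDerivAt_nonneg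
    (f := fun x => S.renormMass 0 x v + x * (ε * (A * G / 2))) hm.2.2
    ((D.mass_u.continuousOn hm).add (continuousOn_id.mul continuousOn_const))
    (fun x hx => (D.mass_u.hasDerivAt hm hx).add ((hasDerivAt_id x).mul_const _))
    (fun x hx => by
      have hmx := mem_of_le_u hm hx.1.le hx.2.le
      have hn := D.nu_neg hmx
      have hr := D.r_pos hmx
      have e1 : -(2 / S.Ω x v ^ 2 * S.lam x v * S.ζ x v ^ 2) =
          -(S.oneSubMu 0 x v * (S.ingoing x v ^ 2 * -S.nu x v) / 2) := by
        rw [D.oneSubMu_eq hmx, ingoing]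
        have := hn.ne
        field_simp
        ring
      have e2 : S.oneSubMu 0 x v ≤ 1 := by
        have h3 := D.mass_nonneg hmx
        have h4 : 0 ≤ 2 * S.renormMass 0 x v / S.r x v := by positivity
        rw [oneSubMu]
        norm_num
        exact h4
      have hn' : 0 ≤ -S.nu x v := by linarith
      have e3 : S.ingoing x v ^ 2 * -S.nu x v ≤ A * G := by
        have h3 := hA x hx
        have h4 := (sq_nonneg _).trans h3
        gcongr
        exact hG x hx
      have e4 : S.oneSubMu 0 x v * (S.ingoing x v ^ 2 * -S.nu x v) ≤
          S.ingoing x v ^ 2 * -S.nu x v :=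
        mul_le_of_le_one_left (by positivity) e2
      rw [e1, one_mul, ← mul_add]
      exact mul_nonneg D.coupling_nonneg (by linarith))
  linarith

/-- An uncharged horizon has positive mass. If its mass vanished identically, the mass would stay
small in a whole strip `u ≥ U - η`, by a continuity argument in `v` along the left end of the
strip. Then `κ` is bounded below on the horizon, where `lam = κ`, and the radius of the horizon
would be unbounded. -/
lemma exists_horizon_mass_pos (D : Collapse γ U R 0 ε S E) :
    ∃ v, 1 ≤ v ∧ 0 < S.renormMass 0 U v := by
  by_contra! h0
  obtain ⟨c, hc, hr⟩ := D.exists_lt_r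
  obtain ⟨B, hB⟩ := D.exists_abs_le_of_le D.contOn_ingoing 1
  have hF := sub_nonneg.2 (D.horizon_energy_le (D.curve.curve_mem le_rfl) le_rfl le_rfl)
  set A := Real.exp (2 * R) * (B ^ 2 + 2 / c ^ 2 * (E (γ 1) 1 - E U 1)) with hAdef
  have hA0 : 0 ≤ A := by positivity
  set G := Real.exp (R / c)
  have hG0 : 0 < G := Real.exp_pos _
  have hε := D.coupling_nonneg
  have hU1 : 1 < U := by simpa [D.curve.start] using D.curve.lt_horizon 1 le_rfl
  set K := ε * (A * G / 2) with hK
  have hK0 : 0 ≤ K := by positivity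
  set η := min (U - 1) (c / (8 * (K + 1))) with hη
  have hη0 : 0 < η := lt_min (by linarith) (by positivity)
  have hηU : 1 ≤ U - η := by linarith [min_le_left (U - 1) (c / (8 * (K + 1)))]
  have hKη : K * η ≤ c / 8 := by
    calc K * η ≤ (K + 1) * (c / (8 * (K + 1))) := by
          gcongr
          · linarith
          · exact min_le_right _ _
      _ = c / 8 := by field_simp
  set w : ℝ → ℝ := fun v => max (U - η) (γ v) with hw
  have hwmem : ∀ v, 1 ≤ v → (w v, v) ∈ region γ U := fun v hv =>
    ⟨hv, le_max_right _ _, max_le (by linarith) (D.curve.lt_horizon v hv).le⟩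
  set ψ : ℝ → ℝ := fun v => S.renormMass 0 (w v) v with hψ
  have hψc : ContinuousOn ψ (Ici 1) :=
    ContinuousOn.comp (f := fun v => (w v, v)) D.contOn_renormMass
      ((continuousOn_const.sup D.curve.continuousOn).prodMk continuousOn_id) hwmem
  have hray : ∀ u v, (u, v) ∈ region γ U → w v ≤ u → (∀ s ∈ Ico 1 v, ψ s ≤ c / 4) →
      ∀ x ∈ Ioo 1 v, S.renormMass 0 u x ≤ c / 4 := by
    intro u v hm hu hs x hx
    refine le_trans ?_ (hs x ⟨hx.1.le, hx.2⟩)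
    exact D.mass_le_u (hwmem x hx.1.le)
      (le_trans (max_le_max le_rfl (D.curve.mono hx.1.le hx.2.le)) hu) hm.2.2
  have himp : ∀ v, 1 ≤ v → (∀ s ∈ Ico 1 v, ψ s ≤ c / 4) → ψ v ≤ c / 8 := by
    intro v hv hs
    have h1 := D.mass_le_of_horizon_mass (A := A) (G := G) (hwmem v hv) (h0 v hv)
      (fun x hx => by
        have hmx := mem_of_le_u (hwmem v hv) hx.1.le hx.2.le
        exact D.ingoing_sq_le_of_mass_le hc hr hB hmx (hray x v hmx hx.1.le hs))
      (fun x hx => by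
        have hmx := mem_of_le_u (hwmem v hv) hx.1.le hx.2.le
        exact D.neg_nu_le_of_mass_le hc hr hmx (hray x v hmx hx.1.le hs))
    have h2 : U - w v ≤ η := by
      have : U - η ≤ w v := le_max_left _ _
      linarith
    exact h1.trans ((mul_le_mul_of_nonneg_left h2 hK0).trans hKη)
  have hsmall : ∀ v, 1 ≤ v → ψ v ≤ c / 4 := by
    by_contra! hbad
    obtain ⟨v, hv, hbv⟩ := hbad
    have hcl : IsClosed {s | s ∈ Icc 1 v ∧ c / 4 ≤ ψ s} :=
      isClosed_Icc.isClosed_le continuousOn_const (hψc.mono fun s hs => hs.1)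
    obtain ⟨s₀, ⟨hs₀, hbs⟩, hmin⟩ :=
      (isCompact_Icc.of_isClosed_subset hcl fun s hs => hs.1).exists_isMinOn (f := id)
        ⟨v, ⟨hv, le_rfl⟩, hbv.le⟩ continuousOn_id
    have := himp s₀ hs₀.1 fun s hs => by
      by_contra! hlt
      have : s₀ ≤ s := hmin (show s ∈ _ from ⟨⟨hs.1, hs.2.le.trans hs₀.2⟩, hlt.le⟩)
      linarith [hs.2]
    linarith
  obtain ⟨V, hV, hγV⟩ := D.curve.exists_eq hηU (by linarith)
  obtain ⟨k, hk, hkv⟩ := D.exists_invKappa_le (v₀ := V) hA0 fun u v hm hv => by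
    refine D.ingoing_sq_le_of_mass_le hc hr hB hm (hray u v hm ?_ fun s hs => hsmall s hs.1)
    exact max_le (by rw [← hγV]; exact (D.curve.mono hV hv).trans hm.2.1) hm.2.1
  obtain ⟨v, hv, hlt⟩ := D.exists_horizon_lam_lt (a := 1 / k) (by positivity) hV
  have hv1 := hV.trans hv
  have hm := D.curve.horizon_mem hv1
  have h1 := D.oneSubMu_eq_mul hm
  have h2 : S.renormMass 0 U v = 0 := le_antisymm (h0 v hv1) (D.mass_nonneg hm)
  have h3 : S.oneSubMu 0 U v = 1 := by simp [oneSubMu, h2]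
  rw [h3] at h1
  have h4 : S.invKappa U v * S.lam U v ≤ k * S.lam U v :=
    mul_le_mul_of_nonneg_right (hkv v hv1 hv) (D.lam_nonneg hm)
  rw [lt_div_iff₀ hk] at hlt
  linarith

end Collapse

/-! ### The two cases -/

variable {γ : ℝ → ℝ} {U R e : ℝ} {S : Fields}

lemma Fields.IsEinsteinMaxwellScalar.collapse (hΓ : IsTimelikeBoundary γ U)
    (hS : S.BoundaryConditions γ U R) (h : S.IsEinsteinMaxwellScalar (region γ U) e)
    (hm : AntitoneOn (fun v => S.hawkingMass (γ v) v) (Ici 1)) :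
    Collapse γ U R e 1 S (S.renormMass e) where
  curve := hΓ
  bdry := hS
  regular := h.regular
  radius := h.radius
  wave := h.wave
  energy := h.mass
  coupling_nonneg := zero_le_one
  mass_u := by simpa only [one_mul] using h.mass.w_u
  mass_v := by simpa only [one_mul] using h.mass.w_v
  mass_init := by
    have := h.regular.r_pos U 1 (hΓ.horizon_mem le_rfl)
    exact add_nonneg hS.mass_init (by positivity)
  energy_antitone := fun v hv w hw hvw => by
    have := hm hv hw hvw
    simp only [renormMass, hS.r_bdry v hv, hS.r_bdry w hw] at this ⊢
    linarith

lemma Fields.IsWaveOnReissnerNordstrom.collapse {M : ℝ} {E : ℝ → ℝ → ℝ}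
    (hΓ : IsTimelikeBoundary γ U) (hS : S.BoundaryConditions γ U R) (hM : |e| < M)
    (h : S.IsWaveOnReissnerNordstrom (region γ U) M e) (hE : S.MassEquations (region γ U) E)
    (hm : AntitoneOn (fun v => E (γ v) v) (Ici 1)) : Collapse γ U R e 0 S E where
  curve := hΓ
  bdry := hS
  regular := h.regular
  radius := h.radius
  wave := h.wave
  energy := hE
  coupling_nonneg := le_rfl
  mass_u := fun u v huv => by
    simp only [zero_mul]
    exact (hasDerivWithinAt_const u _ M).congr (fun x hx => h.const_mass x v hx)
      (h.const_mass u v huv)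
  mass_v := fun u v huv => by
    simp only [zero_mul]
    exact (hasDerivWithinAt_const v _ M).congr (fun x hx => h.const_mass u x hx)
      (h.const_mass u v huv)
  mass_init := by
    rw [h.const_mass U 1 (hΓ.horizon_mem le_rfl)]
    exact (abs_nonneg e).trans hM.le
  energy_antitone := hm

end SphericalCollapse

theorem mainTheorem1 (γ : ℝ → ℝ) (U R e : ℝ) (S : SphericalCollapse.Fields)
    (hΓ : SphericalCollapse.IsTimelikeBoundary γ U)
    (hS : S.BoundaryConditions γ U R) :
    -- the coupled Einstein-Maxwell-scalar field system
    (S.IsEinsteinMaxwellScalar (SphericalCollapse.region γ U) e →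
      AntitoneOn (fun v => S.hawkingMass (γ v) v) (Set.Ici 1) →
      (e ≠ 0 → ∃ v, 1 ≤ v ∧ |e| < S.renormMass e U v) →
      ∀ p : ℝ, 0 < p → ∃ C : ℝ, ∀ u v : ℝ, (u, v) ∈ SphericalCollapse.region γ U →
        |S.θ u v| ≤ C * v ^ (-p)) ∧
    -- the wave equation on a fixed Schwarzschild or Reissner-Nordström background
    (∀ (M : ℝ) (E : ℝ → ℝ → ℝ), |e| < M →
      S.IsWaveOnReissnerNordstrom (SphericalCollapse.region γ U) M e →
      S.MassEquations (SphericalCollapse.region γ U) E →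
      AntitoneOn (fun v => E (γ v) v) (Set.Ici 1) →
      ∀ p : ℝ, 0 < p → ∃ C : ℝ, ∀ u v : ℝ, (u, v) ∈ SphericalCollapse.region γ U →
        |S.θ u v| ≤ C * v ^ (-p)) := by
  refine ⟨fun h hm he p hp => ?_, fun M E hM h hE hm p hp => ?_⟩
  · have D := h.collapse hΓ hS hm
    obtain ⟨v₀, h0, hv₀⟩ : ∃ v, 1 ≤ v ∧ |e| < S.renormMass e U v := by
      by_cases h0 : e = 0
      · subst h0
        simpa using D.exists_horizon_mass_pos
      · exact he h0
    exact D.exists_θ_decay h0 hv₀ hp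
  · have D := h.collapse hΓ hS hM hE hm
    refine D.exists_θ_decay le_rfl ?_ hp
    rwa [h.const_mass U 1 (hΓ.horizon_mem le_rfl)]
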